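/- Let $M$ be an oriented matroid on a finite linearly ordered set $E$. For $A\subseteq E$ let $-_AM$ denote the oriented matroid obtained from $M$ by reversing the signs of the elements of $A$ in all signed circuits. For an oriented matroid $N$ on $E$ let $$O(N)=\{\min(C) : C \text{ a positive circuit of } N\},\qquad O^*(N)=\{\min(D) : D \text{ a positive cocircuit of } N\},$$ where a signed circuit or cocircuit is positive if all its elements have positive sign, and $\min$ is taken over its support. For $A\subseteq E$ put $$\Theta_M(A)=O(-_AM)\setminus A,\quad \bar\Theta_M(A)=O(-_AM)\cap A,\quad \Theta^*_M(A)=O^*(-_AM)\setminus A,\quad \bar\Theta^*_M(A)=O^*(-_AM)\cap A.$$ Let $t(M;X,Y)=\sum_{A\subseteq E}(X-1)^{r(E)-r(A)}(Y-1)^{|A|-r(A)}$ be the Tutte polynomial of the underlying matroid of $M$, where $r$ is its rank function. Then $$t(M;x+u,y+v)=\sum_{A\subseteq E} x^{|\Theta^*_M(A)|}\,u^{|\bar\Theta^*_M(A)|}\,y^{|\Theta_M(A)|}\,v^{|\bar\Theta_M(A)|}$$ as an identity of polynomials in $x,u,y,v$ with integer coefficients; equivalently, for all elements $x,u,y,v$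 of any commutative ring. -/

import Mathlib

/-- The signed set obtained from `X` by reversing the signs of the elements of `A`. -/
def SignedSet.flip {α : Type*} [DecidableEq α] (A : Finset α) (X : α → SignType) : α → SignType :=
  fun e => if e ∈ A then -X e else X e

/-- Two signed sets are orthogonal if some `e` has the same nonzero sign in both and some `f` has
opposite nonzero signs in both, or if neither such `e` nor such `f` exists (which means that the
supports are disjoint). -/
def SignedSet.Orthogonal {α : Type*} (X Y : α → SignType) : Prop :=
  (∃ e, X e * Y e = 1) ↔ (∃ f, X f * Y f = -1)

/-- An oriented matroid on the finite ground set `E`, given by its signed circuits. A signed set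
`(X⁺, X⁻)` is encoded as the function `X : α → SignType` with `X⁺ = {e | X e = 1}` and
`X⁻ = {e | X e = -1}`; its support is `Function.support X`. -/
structure OrientedMatroid (α : Type*) where
  E : Finset α
  IsCircuit : (α → SignType) → Prop
  support_subset : ∀ X, IsCircuit X → Function.support X ⊆ (E : Set α)
  not_isCircuit_zero : ¬ IsCircuit 0
  isCircuit_neg : ∀ X, IsCircuit X → IsCircuit (-X)
  incomparable : ∀ X Y, IsCircuit X → IsCircuit Y →
    Function.support X ⊆ Function.support Y → X = Y ∨ X = -Y
  elimination : ∀ X Y e, IsCircuit X → IsCircuit Y → X ≠ -Y → X e = 1 → Y e = -1 →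
    ∃ Z, IsCircuit Z ∧ Z e = 0 ∧
      (∀ f, Z f = 1 → X f = 1 ∨ Y f = 1) ∧ (∀ f, Z f = -1 → X f = -1 ∨ Y f = -1)

namespace OrientedMatroid

/-- A set is independent if it is a subset of the ground set that contains the support of no
signed circuit. -/
def Indep {α : Type*} (M : OrientedMatroid α) (I : Set α) : Prop :=
  I ⊆ (M.E : Set α) ∧ ∀ X, M.IsCircuit X → ¬ Function.support X ⊆ I

theorem support_neg_eq {α : Type*} (X : α → SignType) :
    Function.support (-X) = Function.support X := by
  have key : ∀ s : SignType, -s ≠ 0 ↔ s ≠ 0 := by decide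
  ext e
  exact key (X e)

/-- Elimination for the supports of signed circuits. -/
theorem support_elimination {α : Type*} (M : OrientedMatroid α) {X Y : α → SignType} {e : α}
    (hX : M.IsCircuit X) (hY : M.IsCircuit Y) (hXY : Function.support X ≠ Function.support Y)
    (heX : X e ≠ 0) (heY : Y e ≠ 0) :
    ∃ Z, M.IsCircuit Z ∧
      Function.support Z ⊆ (Function.support X ∪ Function.support Y) \ {e} := by
  have main : ∀ X Y : α → SignType, M.IsCircuit X → M.IsCircuit Y →
      Function.support X ≠ Function.support Y → X e = 1 → Y e = -1 → ∃ Z, M.IsCircuit Z ∧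
      Function.support Z ⊆ (Function.support X ∪ Function.support Y) \ {e} := by
    intro X Y hX hY hXY h1 h2
    obtain ⟨Z, hZ, hZe, hp, hn⟩ := M.elimination X Y e hX hY
      (fun h => hXY (by rw [h, support_neg_eq])) h1 h2
    refine ⟨Z, hZ, fun f hf => ⟨?_, ?_⟩⟩
    · have hf' : Z f ≠ 0 := hf
      have h3 : Z f = 1 ∨ Z f = -1 := by
        revert hf'; generalize Z f = s; revert s; decide
      simp only [Set.mem_union, Function.mem_support]
      rcases h3 with h | h
      · rcases hp f h with h' | h'
        · left; rw [h']; decide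
        · right; rw [h']; decide
      · rcases hn f h with h' | h'
        · left; rw [h']; decide
        · right; rw [h']; decide
    · rintro rfl
      exact hf hZe
  have tri : ∀ s : SignType, s ≠ 0 → s = 1 ∨ s = -1 := by decide
  have hY' := M.isCircuit_neg Y hY
  have neg1 : ∀ s : SignType, s = 1 → -s = -1 := by decide
  have neg2 : ∀ s : SignType, s = -1 → -s = 1 := by decide
  rcases tri _ heX with h1 | h1 <;> rcases tri _ heY with h2 | h2
  · have := main X (-Y) hX hY' (by rwa [support_neg_eq]) h1 (neg1 _ h2)
    rwa [support_neg_eq] at this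
  · exact main X Y hX hY hXY h1 h2
  · have := main Y X hY hX hXY.symm h2 h1
    rwa [Set.union_comm] at this
  · have := main (-Y) X hY' hX (by rw [support_neg_eq]; exact hXY.symm) (neg2 _ h2) h1
    rwa [support_neg_eq, Set.union_comm] at this

theorem indep_aug {α : Type*} (M : OrientedMatroid α) ⦃I J : Set α⦄ (hI : M.Indep I)
    (hJ : M.Indep J) (hIJ : I.ncard < J.ncard) : ∃ e ∈ J, e ∉ I ∧ M.Indep (insert e I) := by
  classical
  by_contra! hcon
  have hfin : ∀ {K : Set α}, M.Indep K → K.Finite := fun hK => M.E.finite_toSet.subset hK.1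
  have hex : ∃ n, ∃ K, M.Indep K ∧ K ⊆ I ∪ J ∧ I.ncard < K.ncard ∧ (I \ K).ncard = n :=
    ⟨_, J, hJ, Set.subset_union_right, hIJ, rfl⟩
  obtain ⟨K, hK, hKIJ, hcard, hn⟩ := Nat.find_spec hex
  have hmin : ∀ T, M.Indep T → T ⊆ I ∪ J → I.ncard < T.ncard →
      (I \ K).ncard ≤ (I \ T).ncard := fun T h1 h2 h3 =>
    hn ▸ Nat.find_min' hex ⟨T, h1, h2, h3, rfl⟩
  have hKI : ∃ f ∈ K, f ∉ I := by
    by_contra! h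
    exact absurd (Set.ncard_le_ncard h (hfin hI)) (by omega)
  have hIK : ∃ e ∈ I, e ∉ K := by
    by_contra! h
    obtain ⟨f, hfK, hfI⟩ := hKI
    refine hcon f ((hKIJ hfK).resolve_left hfI) hfI ⟨?_, fun X hX hXs => ?_⟩
    · exact fun a ha => hK.1 (ha.elim (fun h' => h' ▸ hfK) (h a))
    · exact hK.2 X hX (hXs.trans fun a ha => ha.elim (fun h' => h' ▸ hfK) (h a))
  obtain ⟨e, heI, heK⟩ := hIK
  have hC : ∀ f ∈ K, f ∉ I → ∃ X, M.IsCircuit X ∧ X e ≠ 0 ∧ X f = 0 ∧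
      Function.support X ⊆ insert e K := by
    intro f hfK hfI
    have hef : e ≠ f := fun h => hfI (h ▸ heI)
    have hnot : ¬ M.Indep ((insert e K) \ {f}) := by
      intro hT
      have h1 := hmin _ hT
        (fun a ha => ha.1.elim (fun h => h ▸ Or.inl heI) (fun h => hKIJ h))
        (by
          rw [Set.ncard_sdiff_singleton_of_mem (Set.mem_insert_of_mem e hfK),
            Set.ncard_insert_of_notMem heK (hfin hK)]
          omega)
      refine absurd h1 (not_le.2 (Set.ncard_lt_ncard ⟨?_, ?_⟩ ((hfin hI).subset Set.sdiff_subset)))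
      · intro a ha
        exact ⟨ha.1, fun h => ha.2 ⟨Set.mem_insert_of_mem _ h, fun h' => hfI (h' ▸ ha.1)⟩⟩
      · intro h
        exact (h ⟨heI, heK⟩).2 ⟨Set.mem_insert _ _, hef⟩
    have hE : (insert e K) \ {f} ⊆ (M.E : Set α) := fun a ha =>
      ha.1.elim (fun h => h ▸ hI.1 heI) (fun h => hK.1 h)
    have : ∃ X, M.IsCircuit X ∧ Function.support X ⊆ (insert e K) \ {f} := by
      by_contra! h
      exact hnot ⟨hE, h⟩
    obtain ⟨X, hX, hXs⟩ := this
    refine ⟨X, hX, fun h => ?_, ?_, hXs.trans Set.sdiff_subset⟩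
    · exact hK.2 X hX fun a ha => (hXs ha).1.resolve_left fun h' => ha (h' ▸ h)
    · by_contra h
      exact (hXs h).2 rfl
  obtain ⟨f, hfK, hfI⟩ := hKI
  obtain ⟨X, hX, hXe, hXf, hXs⟩ := hC f hfK hfI
  have hg : ∃ g ∈ K, g ∉ I ∧ X g ≠ 0 := by
    by_contra! h
    refine hI.2 X hX fun a ha => ?_
    by_contra haI
    rcases hXs ha with h' | h'
    · exact haI (h' ▸ heI)
    · exact ha (h a h' haI)
  obtain ⟨g, hgK, hgI, hXg⟩ := hg
  obtain ⟨Y, hY, hYe, hYg, hYs⟩ := hC g hgK hgI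
  have hne : Function.support X ≠ Function.support Y := fun h => by
    have h1 : g ∈ Function.support Y := h ▸ hXg
    exact h1 hYg
  obtain ⟨Z, hZ, hZs⟩ := M.support_elimination hX hY hne hXe hYe
  exact hK.2 Z hZ fun a ha =>
    ((hZs ha).1.elim (fun h => hXs h) (fun h => hYs h)).resolve_left (hZs ha).2

/-- The underlying matroid: its circuits are the supports of the signed circuits. -/
def underlying {α : Type*} (M : OrientedMatroid α) : Matroid α :=
  (IndepMatroid.ofFinite M.E.finite_toSet M.Indep
    ⟨Set.empty_subset _, fun _ hX h => M.not_isCircuit_zero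
      ((Function.support_eq_empty_iff.1 (Set.subset_empty_iff.1 h)) ▸ hX)⟩
    (fun _ _ hJ hIJ => ⟨hIJ.trans hJ.1, fun X hX h => hJ.2 X hX (h.trans hIJ)⟩)
    M.indep_aug (fun _ hI => hI.1)).matroid

/-- The reorientation `-_A M`. -/
def reorient {α : Type*} [DecidableEq α] (M : OrientedMatroid α) (A : Finset α) :
    OrientedMatroid α where
  E := M.E
  IsCircuit X := M.IsCircuit (SignedSet.flip A X)
  support_subset X hX e he := M.support_subset _ hX (by
    simp only [Function.mem_support, SignedSet.flip] at he ⊢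
    revert he; generalize X e = s; split_ifs <;> revert s <;> decide)
  not_isCircuit_zero h := M.not_isCircuit_zero (by
    have : SignedSet.flip A (0 : α → SignType) = 0 := by
      funext e; simp only [SignedSet.flip, Pi.zero_apply]; split_ifs <;> rfl
    rwa [this] at h)
  isCircuit_neg X hX := by
    have : SignedSet.flip A (-X) = -SignedSet.flip A X := by
      funext e; simp only [SignedSet.flip, Pi.neg_apply]; split_ifs <;> rfl
    rw [this]; exact M.isCircuit_neg _ hX
  incomparable X Y hX hY hXY := by
    have hs : ∀ X : α → SignType,
        Function.support (SignedSet.flip A X) = Function.support X := by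
      intro X; ext e
      simp only [Function.mem_support, SignedSet.flip]
      generalize X e = s; split_ifs <;> revert s <;> decide
    have hflip : ∀ s t : SignType, -s = -t → s = t := by decide
    rcases M.incomparable _ _ hX hY (by rwa [hs, hs]) with h | h
    · left; funext e
      have := congrFun h e
      simp only [SignedSet.flip] at this
      split_ifs at this
      · exact hflip _ _ this
      · exact this
    · right; funext e
      have := congrFun h e
      simp only [SignedSet.flip, Pi.neg_apply] at this ⊢
      split_ifs at this
      · exact hflip _ _ this
      · exact this
  elimination X Y e hX hY hne h1 h2 := by
    have hinv : ∀ X : α → SignType, SignedSet.flip A (SignedSet.flip A X) = X := by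
      intro X; funext e
      simp only [SignedSet.flip]
      generalize X e = s; split_ifs <;> revert s <;> decide
    have hneg : ∀ X : α → SignType, SignedSet.flip A (-X) = -SignedSet.flip A X := by
      intro X; funext e; simp only [SignedSet.flip, Pi.neg_apply]; split_ifs <;> rfl
    have key : ∀ X Y : α → SignType, M.IsCircuit X → M.IsCircuit Y → X ≠ -Y →
        X e = 1 → Y e = -1 → ∃ Z, M.IsCircuit (SignedSet.flip A Z) ∧ Z e = 0 ∧
        (∀ f, Z f = 1 → SignedSet.flip A X f = 1 ∨ SignedSet.flip A Y f = 1) ∧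
        (∀ f, Z f = -1 → SignedSet.flip A X f = -1 ∨ SignedSet.flip A Y f = -1) := by
      intro X Y hX hY hne h1 h2
      obtain ⟨Z, hZ, hZe, hp, hn⟩ := M.elimination X Y e hX hY hne h1 h2
      refine ⟨SignedSet.flip A Z, by rwa [hinv], ?_, fun f => ?_, fun f => ?_⟩
      · simp only [SignedSet.flip, hZe]; split_ifs <;> rfl
      all_goals
        have h3 := hp f
        have h4 := hn f
        simp only [SignedSet.flip]
        revert h3 h4
        generalize X f = s
        generalize Y f = t
        generalize Z f = r
        split_ifs <;> revert s t r <;> decide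
    have hne' : SignedSet.flip A X ≠ -SignedSet.flip A Y := fun h => hne (by
      rw [← hneg] at h
      rw [← hinv X, h, hinv])
    by_cases heA : e ∈ A
    · have := key (SignedSet.flip A Y) (SignedSet.flip A X) hY hX
        (fun h => hne' (by rw [h, neg_neg])) (by simp [SignedSet.flip, heA, h2])
        (by simp [SignedSet.flip, heA, h1])
      simp only [hinv] at this
      obtain ⟨Z, hZ, hZe, hp, hn⟩ := this
      exact ⟨Z, hZ, hZe, fun f hf => (hp f hf).symm, fun f hf => (hn f hf).symm⟩
    · have := key (SignedSet.flip A X) (SignedSet.flip A Y) hX hY hne'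
        (by simp [SignedSet.flip, heA, h1]) (by simp [SignedSet.flip, heA, h2])
      simpa only [hinv] using this

/-- Signed cocircuits (the signed circuits of the dual oriented matroid): the signed sets that are
supported on a cocircuit of the underlying matroid and are orthogonal to all signed circuits. -/
def IsCocircuit {α : Type*} (M : OrientedMatroid α) (Y : α → SignType) : Prop :=
  M.underlying.IsCocircuit (Function.support Y) ∧
    ∀ X, M.IsCircuit X → SignedSet.Orthogonal X Y

/-- The set `O(M)` of active elements: the least elements of the positive circuits. -/
noncomputable def active {α : Type*} [LinearOrder α] (M : OrientedMatroid α) : Finset α :=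
  open scoped Classical in
  M.E.filter fun a => ∃ X, M.IsCircuit X ∧ (∀ e, 0 ≤ X e) ∧ IsLeast (Function.support X) a

/-- The set `O*(M)` of dual-active elements: the least elements of the positive cocircuits. -/
noncomputable def dualActive {α : Type*} [LinearOrder α] (M : OrientedMatroid α) : Finset α :=
  open scoped Classical in
  M.E.filter fun a => ∃ Y, M.IsCocircuit Y ∧ (∀ e, 0 ≤ Y e) ∧ IsLeast (Function.support Y) a

/-- `Θ_M(A) = O(-_A M) \ A`. -/
noncomputable def theta {α : Type*} [LinearOrder α] (M : OrientedMatroid α) (A : Finset α) :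
    Finset α :=
  (M.reorient A).active \ A

/-- `Θ̄_M(A) = O(-_A M) ∩ A`. -/
noncomputable def thetaBar {α : Type*} [LinearOrder α] (M : OrientedMatroid α) (A : Finset α) :
    Finset α :=
  (M.reorient A).active ∩ A

/-- `Θ*_M(A) = O*(-_A M) \ A`. -/
noncomputable def thetaStar {α : Type*} [LinearOrder α] (M : OrientedMatroid α) (A : Finset α) :
    Finset α :=
  (M.reorient A).dualActive \ A

/-- `Θ̄*_M(A) = O*(-_A M) ∩ A`. -/
noncomputable def thetaStarBar {α : Type*} [LinearOrder α] (M : OrientedMatroid α)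
    (A : Finset α) : Finset α :=
  (M.reorient A).dualActive ∩ A

/-- The rank of a set in the underlying matroid. -/
noncomputable def rank {α : Type*} (M : OrientedMatroid α) (A : Finset α) : ℕ :=
  (M.underlying.eRk (A : Set α)).toNat

/-- The Tutte polynomial of the underlying matroid,
`t(M; X₀, X₁) = ∑_{A ⊆ E} (X₀ - 1) ^ (r(E) - r(A)) (X₁ - 1) ^ (|A| - r(A))`. -/
noncomputable def tuttePolynomial {α : Type*} (M : OrientedMatroid α) :
    MvPolynomial (Fin 2) ℤ :=
  ∑ A ∈ M.E.powerset, (MvPolynomial.X 0 - 1) ^ (M.rank M.E - M.rank A) *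
    (MvPolynomial.X 1 - 1) ^ (A.card - M.rank A)

end OrientedMatroid

/-! Both sides satisfy the same deletion–contraction recursion at the largest element `ω` of `E`.
On the right this is a statement about the pair `M`, `-_ω M` (and likewise for `-_A M`): if `ω` is
neither a loop nor a coloop, then the active and dual-active elements of one of the two are those
of `M \ ω`, and those of the other are those of `M / ω`. An element active in `M \ ω` is active in
both, an element is active in `M / ω` if and only if it is active in one of the two, and
orthogonality together with the painting lemma excludes all further possibilities.

Only orthogonality and the following separation property enter here: for disjoint sets `V` and `W`
not containing `a`, there is a circuit through `a` avoiding `V` or a cocircuit through `a` avoiding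
`W`. Both are visibly inherited by duals, minors and reorientations. That an oriented matroid has
the separation property amounts to signing every cocircuit of the underlying matroid orthogonally to
all circuits, where the signs are forced by the fundamental circuits of a basis. -/

namespace SignedSet

theorem sign_mul_nonneg {s t : SignType} (hs : 0 ≤ s) (ht : 0 ≤ t) : 0 ≤ s * t := by
  revert s t
  decide

section Flip

variable {α : Type*} [DecidableEq α] {A : Finset α} {e a : α}

theorem flip_apply_of_notMem (h : e ∉ A) (X : α → SignType) : flip A X e = X e :=
  if_neg h

theorem flip_apply_of_mem (h : e ∈ A) (X : α → SignType) : flip A X e = -X e :=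
  if_pos h

theorem flip_neg (A : Finset α) (X : α → SignType) : flip A (-X) = -flip A X := by
  funext e
  by_cases he : e ∈ A <;> simp [flip, he]

theorem flip_flip (A : Finset α) (X : α → SignType) : flip A (flip A X) = X := by
  funext e
  by_cases he : e ∈ A <;> simp [flip, he]

theorem flip_apply_mul_flip_apply (A : Finset α) (X Y : α → SignType) (e : α) :
    flip A X e * flip A Y e = X e * Y e := by
  by_cases he : e ∈ A <;> simp [flip, he]

theorem flip_apply_eq_zero (A : Finset α) (X : α → SignType) (e : α) :
    flip A X e = 0 ↔ X e = 0 := by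
  by_cases he : e ∈ A <;> simp [flip, he]

theorem support_flip (A : Finset α) (X : α → SignType) :
    Function.support (flip A X) = Function.support X :=
  Set.ext fun e => (flip_apply_eq_zero A X e).not

theorem flip_insert (h : a ∉ A) (X : α → SignType) :
    flip (insert a A) X = flip A (flip {a} X) := by
  funext e
  by_cases hea : e = a
  · simp [flip, hea, h]
  · simp [flip, hea]

theorem flip_singleton_of_ne (h : e ≠ a) (X : α → SignType) : flip {a} X e = X e :=
  flip_apply_of_notMem (by simpa using h) X

theorem flip_singleton_self (a : α) (X : α → SignType) : flip {a} X a = -X a :=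
  flip_apply_of_mem (Finset.mem_singleton_self a) X

theorem flip_singleton_of_apply_eq_zero {X : α → SignType} (h : X a = 0) : flip {a} X = X := by
  funext e
  by_cases hea : e = a
  · rw [hea, flip_singleton_self, h, neg_zero]
  · exact flip_singleton_of_ne hea X

end Flip

section DualPair

variable {α : Type*} {C D K : Set (α → SignType)} {S T P A B V : Finset α} {a b ω : α}

/-- Some member of the family `K` has `a`, but no element of `B`, in its support. -/
def Separates (K : Set (α → SignType)) (a : α) (B : Finset α) : Prop :=
  ∃ X ∈ K, X a ≠ 0 ∧ ∀ e ∈ B, X e = 0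

theorem Separates.anti (h : Separates K a B) (hVB : V ⊆ B) : Separates K a V :=
  let ⟨X, hX, hXa, hXB⟩ := h
  ⟨X, hX, hXa, fun e he => hXB e (hVB he)⟩

/-- The signed sets in `K` whose support avoids `ω`. On the family of signed circuits this deletes
`ω`, on the family of signed cocircuits it contracts `ω`. -/
def avoiding (ω : α) (K : Set (α → SignType)) : Set (α → SignType) :=
  {X ∈ K | X ω = 0}

theorem separates_insert_iff [DecidableEq α] :
    Separates K a (insert ω B) ↔ Separates (avoiding ω K) a B := by
  simp only [Separates, avoiding, Finset.forall_mem_insert, Set.mem_ofPred_eq]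
  tauto

theorem exists_apply_eq_one_of_separates (hK : ∀ X ∈ K, -X ∈ K) (h : Separates K a B) :
    ∃ X ∈ K, X a = 1 ∧ ∀ e ∈ B, X e = 0 := by
  obtain ⟨X, hX, hXa, hXB⟩ := h
  rcases (by decide : ∀ s : SignType, s ≠ 0 → s = 1 ∨ -s = 1) _ hXa with h | h
  · exact ⟨X, hX, h, hXB⟩
  · exact ⟨-X, hK X hX, h, fun e he => by rw [Pi.neg_apply, hXB e he, neg_zero]⟩

variable [DecidableEq α]

theorem preimage_flip_flip (A : Finset α) (K : Set (α → SignType)) :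
    flip A ⁻¹' (flip A ⁻¹' K) = K := by
  ext X
  simp only [Set.mem_preimage, flip_flip]

theorem preimage_flip_insert (hω : ω ∉ A) (K : Set (α → SignType)) :
    flip (insert ω A) ⁻¹' K = flip {ω} ⁻¹' (flip A ⁻¹' K) := by
  ext X
  simp only [Set.mem_preimage, flip_insert hω]

theorem avoiding_preimage_flip (ω : α) (A : Finset α) (K : Set (α → SignType)) :
    avoiding ω (flip A ⁻¹' K) = flip A ⁻¹' avoiding ω K := by
  ext X
  exact and_congr_right fun _ => (flip_apply_eq_zero A X ω).symm

theorem avoiding_preimage_flip_singleton (ω : α) (K : Set (α → SignType)) :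
    avoiding ω (flip {ω} ⁻¹' K) = avoiding ω K := by
  ext X
  refine and_congr_left fun hX => ?_
  rw [Set.mem_preimage, flip_singleton_of_apply_eq_zero hX]

theorem separates_preimage_flip : Separates (flip A ⁻¹' K) a B ↔ Separates K a B := by
  suffices separates_flip : ∀ {L}, Separates L a B → Separates (flip A ⁻¹' L) a B from
    ⟨fun h => preimage_flip_flip A K ▸ separates_flip h, separates_flip⟩
  rintro L ⟨X, hX, hXa, hXB⟩
  exact ⟨flip A X, by rwa [Set.mem_preimage, flip_flip], (flip_apply_eq_zero A X a).not.2 hXa,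
    fun e he => (flip_apply_eq_zero A X e).2 (hXB e he)⟩

/-- The families `C` and `D` behave on `S` like the signed circuits and the signed cocircuits of an
oriented matroid. The signed sets may be nonzero outside `S`, and their values there are ignored,
so that passing to a minor never restricts a function. Neither family is required to consist of
signed sets of minimal support. -/
structure IsDualPair (S : Finset α) (C D : Set (α → SignType)) : Prop where
  neg_left : ∀ X ∈ C, -X ∈ C
  neg_right : ∀ Y ∈ D, -Y ∈ D
  orthogonal : ∀ X ∈ C, ∀ Y ∈ D, (∀ e ∈ S, 0 ≤ X e * Y e) → ∀ e ∈ S, X e * Y e = 0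
  separates : ∀ a ∈ S, ∀ V ⊆ S.erase a, ∀ W ⊆ S.erase a, Disjoint V W →
    Separates C a V ∨ Separates D a W

namespace IsDualPair

theorem symm (h : IsDualPair S C D) : IsDualPair S D C where
  neg_left := h.neg_right
  neg_right := h.neg_left
  orthogonal Y hY X hX hpos e he := by
    rw [mul_comm]
    exact h.orthogonal X hX Y hY (fun f hf => mul_comm (X f) (Y f) ▸ hpos f hf) e he
  separates a ha V hV W hW hVW := (h.separates a ha W hW V hV hVW.symm).symm

theorem reorient (h : IsDualPair S C D) (A : Finset α) :
    IsDualPair S (flip A ⁻¹' C) (flip A ⁻¹' D) where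
  neg_left X hX := by
    rw [Set.mem_preimage, flip_neg]
    exact h.neg_left _ hX
  neg_right Y hY := by
    rw [Set.mem_preimage, flip_neg]
    exact h.neg_right _ hY
  orthogonal X hX Y hY hpos e he := by
    rw [← flip_apply_mul_flip_apply A]
    exact h.orthogonal _ hX _ hY
      (fun f hf => (flip_apply_mul_flip_apply A X Y f).symm ▸ hpos f hf) e he
  separates a ha V hV W hW hVW :=
    (h.separates a ha V hV W hW hVW).imp separates_preimage_flip.2 separates_preimage_flip.2

theorem delete (h : IsDualPair (insert ω T) C D) (hω : ω ∉ T) :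
    IsDualPair T (avoiding ω C) D where
  neg_left X hX := ⟨h.neg_left X hX.1, by rw [Pi.neg_apply, hX.2, neg_zero]⟩
  neg_right := h.neg_right
  orthogonal X hX Y hY hpos e he := by
    refine h.orthogonal X hX.1 Y hY (fun f hf => ?_) e (Finset.mem_insert_of_mem he)
    rcases Finset.mem_insert.1 hf with rfl | hf
    · rw [hX.2, zero_mul]
    · exact hpos f hf
  separates a ha V hV W hW hVW := by
    have hωa : ω ≠ a := fun h => hω (h ▸ ha)
    rw [← separates_insert_iff]
    refine h.separates a (Finset.mem_insert_of_mem ha) _ ?_ W ?_ ?_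
    · rw [Finset.erase_insert_of_ne hωa]
      exact Finset.insert_subset_insert ω hV
    · exact hW.trans (Finset.erase_subset_erase a (Finset.subset_insert ω T))
    · exact Finset.disjoint_insert_left.2 ⟨fun hωW => hω (Finset.mem_of_mem_erase (hW hωW)), hVW⟩

theorem contract (h : IsDualPair (insert ω T) C D) (hω : ω ∉ T) :
    IsDualPair T C (avoiding ω D) :=
  (h.symm.delete hω).symm

theorem not_forall_mul_nonneg (h : IsDualPair S C D) {X Y : α → SignType} (hX : X ∈ C)
    (hY : Y ∈ D) (ha : a ∈ S) (hXa : X a = 1) (hYa : Y a = 1) :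
    ¬∀ e ∈ S, 0 ≤ X e * Y e := fun hXY => by
  have := h.orthogonal X hX Y hY hXY a ha
  rw [hXa, hYa] at this
  exact absurd this (by decide)

theorem nonneg_of_apply_neg (h : IsDualPair S C D) {X Y : α → SignType} (hX : X ∈ C) (hY : Y ∈ D)
    (ha : a ∈ S) (hXa : X a = 1) (hYa : Y a = 1) (hXY : ∀ e ∈ S, e ≠ b → 0 ≤ X e * Y e)
    (hXb : X b < 0) : 0 ≤ Y b := by
  by_contra! hYb
  refine h.not_forall_mul_nonneg hX hY ha hXa hYa fun e he => ?_
  by_cases heb : e = b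
  · rw [heb]
    exact (by decide : ∀ s t : SignType, s < 0 → t < 0 → 0 ≤ s * t) _ _ hXb hYb
  · exact hXY e he heb

/-- The painting lemma of Minty, the combinatorial form of the lemma of Farkas. -/
theorem painting (h : IsDualPair S C D) (ha : a ∈ S) (hP : P ⊆ S.erase a) :
    (∃ X ∈ C, X a = 1 ∧ (∀ e ∈ P, 0 ≤ X e) ∧ ∀ e ∈ S, e ≠ a → e ∉ P → X e = 0) ∨
      ∃ Y ∈ D, Y a = 1 ∧ ∀ e ∈ P, 0 ≤ Y e := by
  induction P using Finset.induction_on generalizing S C D with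
  | empty =>
    rcases h.separates a ha _ subset_rfl ∅ (Finset.empty_subset _)
      (Finset.disjoint_empty_right _) with hC | hD
    · obtain ⟨X, hX, hXa, hX0⟩ := exists_apply_eq_one_of_separates h.neg_left hC
      exact Or.inl ⟨X, hX, hXa, by simp, fun e he hea _ => hX0 e (Finset.mem_erase.2 ⟨hea, he⟩)⟩
    · obtain ⟨Y, hY, hYa, -⟩ := exists_apply_eq_one_of_separates h.neg_right hD
      exact Or.inr ⟨Y, hY, hYa, by simp⟩
  | insert b P hbP ih =>
    obtain ⟨hb, hP⟩ := Finset.insert_subset_iff.1 hP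
    obtain ⟨hba, hbS⟩ := Finset.mem_erase.1 hb
    rcases ih h ha hP with ⟨X, hX, hXa, hXP, hX0⟩ | ⟨Y, hY, hYa, hYP⟩
    · refine Or.inl ⟨X, hX, hXa, ?_, fun e he hea heP => hX0 e he hea ?_⟩
      · exact Finset.forall_mem_insert _ _ _ |>.2 ⟨(hX0 b hbS hba hbP).ge, hXP⟩
      · exact fun h => heP (Finset.mem_insert_of_mem h)
    have contraction : IsDualPair (S.erase b) C (avoiding b D) :=
      IsDualPair.contract (by rwa [Finset.insert_erase hbS]) (Finset.notMem_erase b S)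
    have hP' : P ⊆ (S.erase b).erase a := by
      rw [Finset.erase_right_comm]
      exact Finset.subset_erase.2 ⟨hP, hbP⟩
    rcases ih contraction (Finset.mem_erase.2 ⟨hba.symm, ha⟩) hP' with
      ⟨X, hX, hXa, hXP, hX0⟩ | ⟨Y', ⟨hY', hY'b⟩, hY'a, hY'P⟩
    · rcases le_or_gt 0 (X b) with hXb | hXb
      · refine Or.inl ⟨X, hX, hXa, Finset.forall_mem_insert _ _ _ |>.2 ⟨hXb, hXP⟩, ?_⟩
        intro e he hea heP
        rw [Finset.mem_insert, not_or] at heP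
        exact hX0 e (Finset.mem_erase.2 ⟨heP.1, he⟩) hea heP.2
      refine Or.inr ⟨Y, hY, hYa, Finset.forall_mem_insert _ _ _ |>.2 ⟨?_, hYP⟩⟩
      refine h.nonneg_of_apply_neg hX hY ha hXa hYa (fun e he heb => ?_) hXb
      by_cases hea : e = a
      · rw [hea, hXa, hYa]; decide
      by_cases heP : e ∈ P
      · exact sign_mul_nonneg (hXP e heP) (hYP e heP)
      · rw [hX0 e (Finset.mem_erase.2 ⟨heb, he⟩) hea heP, zero_mul]
    · exact Or.inr ⟨Y', hY', hY'a, Finset.forall_mem_insert _ _ _ |>.2 ⟨hY'b.ge, hY'P⟩⟩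

end IsDualPair

end DualPair

section Activity

variable {α : Type*} [LinearOrder α] {C D K : Set (α → SignType)} {S T : Finset α} {a b ω : α}

open scoped Classical in
/-- The least elements of the supports on `S` of those members of `K` that are nonnegative
on `S`. -/
noncomputable def activeSet (K : Set (α → SignType)) (S : Finset α) : Finset α :=
  {a ∈ S | ∃ X ∈ K, X a = 1 ∧ (∀ e ∈ S, 0 ≤ X e) ∧ ∀ e ∈ S, e < a → X e = 0}

theorem mem_activeSet : a ∈ activeSet K S ↔
    a ∈ S ∧ ∃ X ∈ K, X a = 1 ∧ (∀ e ∈ S, 0 ≤ X e) ∧ ∀ e ∈ S, e < a → X e = 0 := by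
  simp only [activeSet, Finset.mem_filter]

theorem activeSet_subset : activeSet K S ⊆ S :=
  fun _ ha => (mem_activeSet.1 ha).1

theorem activeSet_mono {L : Set (α → SignType)} (h : K ⊆ L) : activeSet K S ⊆ activeSet L S := by
  intro a ha
  obtain ⟨haS, X, hX, hXS⟩ := mem_activeSet.1 ha
  exact mem_activeSet.2 ⟨haS, X, h hX, hXS⟩

theorem IsDualPair.exists_of_notMem_activeSet (h : IsDualPair S C D) (ha : a ∈ S)
    (haC : a ∉ activeSet C S) : ∃ Y ∈ D, Y a = 1 ∧ ∀ e ∈ S, a < e → 0 ≤ Y e := by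
  have hP : {e ∈ S | a < e} ⊆ S.erase a := fun e he => by
    rw [Finset.mem_filter] at he
    exact Finset.mem_erase.2 ⟨he.2.ne', he.1⟩
  rcases h.painting ha hP with ⟨X, hX, hXa, hXP, hX0⟩ | ⟨Y, hY, hYa, hYP⟩
  · have hXlt : ∀ e ∈ S, e < a → X e = 0 := fun e he hea =>
      hX0 e he hea.ne fun heP => hea.not_gt (Finset.mem_filter.1 heP).2
    refine absurd (mem_activeSet.2 ⟨ha, X, hX, hXa, fun e he => ?_, hXlt⟩) haC
    rcases lt_trichotomy e a with hea | rfl | hae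
    · exact (hXlt e he hea).ge
    · rw [hXa]; decide
    · exact hXP e (Finset.mem_filter.2 ⟨he, hae⟩)
  · exact ⟨Y, hY, hYa, fun e he hae => hYP e (Finset.mem_filter.2 ⟨he, hae⟩)⟩

theorem activeSet_avoiding_subset :
    activeSet (avoiding ω K) T ⊆ activeSet K (insert ω T) := by
  intro a ha
  obtain ⟨haT, X, ⟨hX, hXω⟩, hXa, hX0, hXlt⟩ := mem_activeSet.1 ha
  exact mem_activeSet.2 ⟨Finset.mem_insert_of_mem haT, X, hX, hXa,
    Finset.forall_mem_insert _ _ _ |>.2 ⟨hXω.ge, hX0⟩,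
    Finset.forall_mem_insert _ _ _ |>.2 ⟨fun _ => hXω, hXlt⟩⟩

theorem activeSet_preimage_flip_singleton (hω : ω ∉ T) :
    activeSet (flip {ω} ⁻¹' K) T = activeSet K T := by
  suffices subset : ∀ L, activeSet L T ⊆ activeSet (flip {ω} ⁻¹' L) T from
    (preimage_flip_flip {ω} K ▸ subset (flip {ω} ⁻¹' K)).antisymm (subset K)
  intro L a ha
  obtain ⟨haT, X, hX, hXa, hX0, hXlt⟩ := mem_activeSet.1 ha
  have hflip : ∀ e ∈ T, flip {ω} X e = X e := fun e he =>
    flip_singleton_of_ne (ne_of_mem_of_not_mem he hω) X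
  exact mem_activeSet.2 ⟨haT, flip {ω} X, by rwa [Set.mem_preimage, flip_flip],
    hflip a haT ▸ hXa, fun e he => hflip e he ▸ hX0 e he,
    fun e he hea => hflip e he ▸ hXlt e he hea⟩

theorem mem_activeSet_insert_iff (hωT : ∀ e ∈ T, e < ω) (ha : a ∈ T) :
    a ∈ activeSet K (insert ω T) ↔ ∃ X ∈ K, X a = 1 ∧ (∀ e ∈ T, 0 ≤ X e) ∧
      (∀ e ∈ T, e < a → X e = 0) ∧ 0 ≤ X ω := by
  simp only [mem_activeSet, Finset.forall_mem_insert, Finset.mem_insert_of_mem ha, true_and,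
    (hωT a ha).not_gt, false_imp_iff]
  tauto

theorem mem_activeSet_insert_preimage_flip_iff (hωT : ∀ e ∈ T, e < ω) (ha : a ∈ T) :
    a ∈ activeSet (flip {ω} ⁻¹' K) (insert ω T) ↔ ∃ X ∈ K, X a = 1 ∧ (∀ e ∈ T, 0 ≤ X e) ∧
      (∀ e ∈ T, e < a → X e = 0) ∧ X ω ≤ 0 := by
  have hflip : ∀ X, ∀ e ∈ T, flip {ω} X e = X e := fun X e he =>
    flip_singleton_of_ne (hωT e he).ne X
  have neg_nonneg : ∀ s : SignType, 0 ≤ -s ↔ s ≤ 0 := by decide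
  have nonneg_neg : ∀ s : SignType, -s ≤ 0 ↔ 0 ≤ s := by decide
  rw [mem_activeSet_insert_iff hωT ha]
  constructor
  · rintro ⟨X, hX, hXa, hX0, hXlt, hXω⟩
    exact ⟨flip {ω} X, hX, by rwa [hflip X a ha], fun e he => by rw [hflip X e he]; exact hX0 e he,
      fun e he hea => by rw [hflip X e he]; exact hXlt e he hea,
      by rwa [flip_singleton_self, nonneg_neg]⟩
  · rintro ⟨X, hX, hXa, hX0, hXlt, hXω⟩
    exact ⟨flip {ω} X, by rwa [Set.mem_preimage, flip_flip], by rwa [hflip X a ha],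
      fun e he => by rw [hflip X e he]; exact hX0 e he,
      fun e he hea => by rw [hflip X e he]; exact hXlt e he hea,
      by rwa [flip_singleton_self, neg_nonneg]⟩

theorem mem_activeSet_insert_or_preimage_flip_iff (hωT : ∀ e ∈ T, e < ω) (ha : a ∈ T) :
    a ∈ activeSet K (insert ω T) ∨ a ∈ activeSet (flip {ω} ⁻¹' K) (insert ω T) ↔
      a ∈ activeSet K T := by
  rw [mem_activeSet_insert_iff hωT ha, mem_activeSet_insert_preimage_flip_iff hωT ha,
    mem_activeSet]
  constructor
  · rintro (⟨X, hX, hXa, hX0, hXlt, -⟩ | ⟨X, hX, hXa, hX0, hXlt, -⟩) <;>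
      exact ⟨ha, X, hX, hXa, hX0, hXlt⟩
  · rintro ⟨-, X, hX, hXa, hX0, hXlt⟩
    exact (le_total 0 (X ω)).imp (fun hXω => ⟨X, hX, hXa, hX0, hXlt, hXω⟩)
      fun hXω => ⟨X, hX, hXa, hX0, hXlt, hXω⟩

theorem IsDualPair.mem_activeSet_avoiding_or (h : IsDualPair (insert ω T) C D)
    (hωT : ∀ e ∈ T, e < ω) (ha : a ∈ T) (hb : b ∈ T) (haC : a ∈ activeSet C (insert ω T))
    (hbC : b ∈ activeSet (flip {ω} ⁻¹' C) (insert ω T)) :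
    a ∈ activeSet (avoiding ω C) T ∨ b ∈ activeSet (avoiding ω C) T := by
  wlog hab : a ≤ b generalizing a b C D
  · have := this (h.reorient {ω}) hb ha hbC (by rwa [preimage_flip_flip]) (le_of_not_ge hab)
    rwa [avoiding_preimage_flip_singleton, or_comm] at this
  refine or_iff_not_imp_left.2 fun haDel => ?_
  obtain ⟨X, hX, hXa, hX0, hXlt, hXω⟩ := (mem_activeSet_insert_iff hωT ha).1 haC
  obtain ⟨Z, hZ, hZb, hZ0, hZlt, hZω⟩ := (mem_activeSet_insert_preimage_flip_iff hωT hb).1 hbC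
  have hωT' : ω ∉ T := fun hω => (hωT ω hω).false
  obtain ⟨Y, hY, hYa, hYgt⟩ := (h.delete hωT').exists_of_notMem_activeSet ha haDel
  have hYge : ∀ e ∈ T, a ≤ e → 0 ≤ Y e := fun e he hae => by
    rcases hae.eq_or_lt with rfl | hae
    · rw [hYa]; decide
    · exact hYgt e he hae
  have nonneg_of_zero_below : ∀ W : α → SignType, (∀ e ∈ T, 0 ≤ W e) →
      (∀ e ∈ T, e < a → W e = 0) → ∀ e ∈ T, 0 ≤ W e * Y e := fun W hW0 hWlt e he => by
    rcases lt_or_ge e a with hea | hae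
    · rw [hWlt e he hea, zero_mul]
    · exact sign_mul_nonneg (hW0 e he) (hYge e he hae)
  -- `X` and `Y` agree in sign at `a`, so they must disagree at `ω`.
  have hYω : Y ω < 0 := by
    by_contra! hYω
    exact h.not_forall_mul_nonneg hX hY (Finset.mem_insert_of_mem ha) hXa hYa
      (Finset.forall_mem_insert _ _ _ |>.2
        ⟨sign_mul_nonneg hXω hYω, nonneg_of_zero_below X hX0 hXlt⟩)
  have hZYω : 0 ≤ Z ω * Y ω :=
    (by decide : ∀ s t : SignType, s ≤ 0 → t < 0 → 0 ≤ s * t) _ _ hZω hYω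
  have hZωYω : Z ω * Y ω = 0 := h.orthogonal Z hZ Y hY (Finset.forall_mem_insert _ _ _ |>.2
    ⟨hZYω, nonneg_of_zero_below Z hZ0 fun e he hea => hZlt e he (hea.trans_le hab)⟩) ω
    (Finset.mem_insert_self ω T)
  have hZω : Z ω = 0 := (mul_eq_zero.1 hZωYω).resolve_right hYω.ne
  exact mem_activeSet.2 ⟨hb, Z, ⟨hZ, hZω⟩, hZb, hZ0, hZlt⟩

theorem activeSet_insert_subset (h : ¬Separates K ω T) (hωT : ∀ e ∈ T, e < ω) :
    activeSet K (insert ω T) ⊆ T := by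
  intro a ha
  obtain ⟨haS, X, hX, hXa, -, hXlt⟩ := mem_activeSet.1 ha
  refine (Finset.mem_insert.1 haS).resolve_left fun haω => h ⟨X, hX, ?_, fun e he => ?_⟩
  · rw [← haω, hXa]; decide
  · exact hXlt e (Finset.mem_insert_of_mem he) (haω ▸ hωT e he)

theorem IsDualPair.activeSet_insert_eq_or (h : IsDualPair (insert ω T) C D)
    (hωT : ∀ e ∈ T, e < ω) (hC : ¬Separates C ω T) :
    activeSet C (insert ω T) = activeSet (avoiding ω C) T ∧
        activeSet (flip {ω} ⁻¹' C) (insert ω T) = activeSet C T ∨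
      activeSet C (insert ω T) = activeSet C T ∧
        activeSet (flip {ω} ⁻¹' C) (insert ω T) = activeSet (avoiding ω C) T := by
  have hO : activeSet C (insert ω T) ⊆ T := activeSet_insert_subset hC hωT
  have hO' : activeSet (flip {ω} ⁻¹' C) (insert ω T) ⊆ T :=
    activeSet_insert_subset (separates_preimage_flip.not.2 hC) hωT
  have hdel : activeSet (avoiding ω C) T ⊆ activeSet C (insert ω T) := activeSet_avoiding_subset
  have hdel' : activeSet (avoiding ω C) T ⊆ activeSet (flip {ω} ⁻¹' C) (insert ω T) :=
    avoiding_preimage_flip_singleton ω C ▸ activeSet_avoiding_subset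
  have hcon : activeSet C T =
      activeSet C (insert ω T) ∪ activeSet (flip {ω} ⁻¹' C) (insert ω T) := by
    ext a
    rw [Finset.mem_union]
    by_cases haT : a ∈ T
    · exact (mem_activeSet_insert_or_preimage_flip_iff hωT haT).symm
    · exact iff_of_false (fun h => haT (activeSet_subset h))
        (not_or.2 ⟨fun h => haT (hO h), fun h => haT (hO' h)⟩)
  rw [hcon]
  by_cases hsub : activeSet C (insert ω T) ⊆ activeSet (avoiding ω C) T
  · have heq := hsub.antisymm hdel
    exact Or.inl ⟨heq, (Finset.union_eq_right.2 (heq ▸ hdel')).symm⟩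
  · obtain ⟨a, ha, haDel⟩ := Finset.not_subset.1 hsub
    have heq : activeSet (flip {ω} ⁻¹' C) (insert ω T) = activeSet (avoiding ω C) T :=
      Finset.Subset.antisymm (fun b hb => (h.mem_activeSet_avoiding_or hωT (hO ha) (hO' hb) ha
        hb).resolve_left haDel) hdel'
    exact Or.inr ⟨(Finset.union_eq_left.2 (heq ▸ hdel)).symm, heq⟩

theorem IsDualPair.activeSet_subset_preimage_flip_or (h : IsDualPair (insert ω T) C D) :
    activeSet C (insert ω T) ⊆ activeSet (flip {ω} ⁻¹' C) (insert ω T) ∨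
      activeSet D (insert ω T) ⊆ activeSet (flip {ω} ⁻¹' D) (insert ω T) := by
  have exists_pos_of_not_subset {K : Set (α → SignType)}
      (hK : ¬activeSet K (insert ω T) ⊆ activeSet (flip {ω} ⁻¹' K) (insert ω T)) :
      ∃ X ∈ K, (∀ e ∈ insert ω T, 0 ≤ X e) ∧ X ω ≠ 0 := by
    obtain ⟨a, ha, ha'⟩ := Finset.not_subset.1 hK
    obtain ⟨haS, X, hX, hXa, hX0, hXlt⟩ := mem_activeSet.1 ha
    refine ⟨X, hX, hX0, fun hXω => ha' (mem_activeSet.2 ⟨haS, X, ?_, hXa, hX0, hXlt⟩)⟩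
    rwa [Set.mem_preimage, flip_singleton_of_apply_eq_zero hXω]
  by_contra! ⟨hC, hD⟩
  obtain ⟨X, hX, hX0, hXω⟩ := exists_pos_of_not_subset hC
  obtain ⟨Y, hY, hY0, hYω⟩ := exists_pos_of_not_subset hD
  exact mul_ne_zero hXω hYω (h.orthogonal X hX Y hY
    (fun e he => sign_mul_nonneg (hX0 e he) (hY0 e he)) ω (Finset.mem_insert_self ω T))

theorem IsDualPair.activeSet_dichotomy (h : IsDualPair (insert ω T) C D)
    (hωT : ∀ e ∈ T, e < ω) (hC : ¬Separates C ω T) (hD : ¬Separates D ω T) :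
    (activeSet C (insert ω T) = activeSet (avoiding ω C) T ∧
        activeSet D (insert ω T) = activeSet D T ∧
        activeSet (flip {ω} ⁻¹' C) (insert ω T) = activeSet C T ∧
        activeSet (flip {ω} ⁻¹' D) (insert ω T) = activeSet (avoiding ω D) T) ∨
      activeSet C (insert ω T) = activeSet C T ∧
        activeSet D (insert ω T) = activeSet (avoiding ω D) T ∧
        activeSet (flip {ω} ⁻¹' C) (insert ω T) = activeSet (avoiding ω C) T ∧
        activeSet (flip {ω} ⁻¹' D) (insert ω T) = activeSet D T := by
  have hmixed := h.activeSet_subset_preimage_flip_or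
  have hmixed' := (h.reorient {ω}).activeSet_subset_preimage_flip_or
  simp only [preimage_flip_flip] at hmixed'
  have hdelC : activeSet (avoiding ω C) T ⊆ activeSet C T := activeSet_mono fun _ hX => hX.1
  have hdelD : activeSet (avoiding ω D) T ⊆ activeSet D T := activeSet_mono fun _ hX => hX.1
  rcases h.activeSet_insert_eq_or hωT hC with ⟨hO, hO'⟩ | ⟨hO, hO'⟩ <;>
    rcases h.symm.activeSet_insert_eq_or hωT hD with ⟨hN, hN'⟩ | ⟨hN, hN'⟩ <;>
    rw [hO, hO', hN, hN'] at hmixed hmixed' ⊢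
  · rcases hmixed' with hsub | hsub
    · exact Or.inr ⟨hdelC.antisymm hsub, rfl, hsub.antisymm hdelC, rfl⟩
    · exact Or.inl ⟨rfl, hdelD.antisymm hsub, rfl, hsub.antisymm hdelD⟩
  · exact Or.inl ⟨rfl, rfl, rfl, rfl⟩
  · exact Or.inr ⟨rfl, rfl, rfl, rfl⟩
  · rcases hmixed with hsub | hsub
    · exact Or.inl ⟨hsub.antisymm hdelC, rfl, hdelC.antisymm hsub, rfl⟩
    · exact Or.inr ⟨rfl, hsub.antisymm hdelD, rfl, hdelD.antisymm hsub⟩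

theorem IsDualPair.apply_eq_zero_of_separates (h : IsDualPair (insert ω T) C D)
    (hC : Separates C ω T) {Y : α → SignType} (hY : Y ∈ D) : Y ω = 0 := by
  obtain ⟨X, hX, hXω, hXT⟩ := hC
  have eq_zero_of_nonneg : ∀ Z ∈ D, 0 ≤ X ω * Z ω → Z ω = 0 := fun Z hZ hXZ => by
    have := h.orthogonal X hX Z hZ (Finset.forall_mem_insert _ _ _ |>.2
      ⟨hXZ, fun e he => by rw [hXT e he, zero_mul]⟩) ω (Finset.mem_insert_self ω T)
    exact (mul_eq_zero.1 this).resolve_left hXω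
  rcases (by decide : ∀ s t : SignType, 0 ≤ s * t ∨ 0 ≤ s * -t) (X ω) (Y ω) with hXY | hXY
  · exact eq_zero_of_nonneg Y hY hXY
  · exact SignType.neg_eq_zero_iff.1 (eq_zero_of_nonneg (-Y) (h.neg_right Y hY) hXY)

theorem IsDualPair.activeSet_left_insert_of_separates (h : IsDualPair (insert ω T) C D)
    (hωT : ∀ e ∈ T, e < ω) (hC : Separates C ω T) :
    activeSet C (insert ω T) = insert ω (activeSet (avoiding ω C) T) := by
  have hω : ω ∉ T := fun hω => (hωT ω hω).false
  refine Finset.Subset.antisymm (fun a ha => ?_) (Finset.insert_subset ?_ activeSet_avoiding_subset)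
  · rcases Finset.mem_insert.1 (activeSet_subset ha) with rfl | haT
    · exact Finset.mem_insert_self _ _
    refine Finset.mem_insert_of_mem ?_
    by_contra haDel
    obtain ⟨X, hX, hXa, hX0, hXlt, -⟩ := (mem_activeSet_insert_iff hωT haT).1 ha
    obtain ⟨Y, hY, hYa, hYgt⟩ := (h.delete hω).exists_of_notMem_activeSet haT haDel
    refine h.not_forall_mul_nonneg hX hY (Finset.mem_insert_of_mem haT) hXa hYa
      (Finset.forall_mem_insert _ _ _ |>.2 ⟨?_, fun e he => ?_⟩)
    · rw [h.apply_eq_zero_of_separates hC hY, mul_zero]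
    rcases lt_trichotomy e a with hea | rfl | hae
    · rw [hXlt e he hea, zero_mul]
    · rw [hXa, hYa]; decide
    · exact sign_mul_nonneg (hX0 e he) (hYgt e he hae)
  · obtain ⟨X, hX, hXω, hXT⟩ := exists_apply_eq_one_of_separates h.neg_left hC
    refine mem_activeSet.2 ⟨Finset.mem_insert_self ω T, X, hX, hXω, ?_, ?_⟩ <;>
      refine Finset.forall_mem_insert _ _ _ |>.2 ⟨?_, fun e he => ?_⟩
    · rw [hXω]; decide
    · exact (hXT e he).ge
    · exact fun hωω => absurd hωω (lt_irrefl ω)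
    · exact fun _ => hXT e he

theorem IsDualPair.activeSet_right_insert_of_separates (h : IsDualPair (insert ω T) C D)
    (hC : Separates C ω T) : activeSet D (insert ω T) = activeSet D T := by
  have hY0 : ∀ Y ∈ D, Y ω = 0 := fun Y hY => h.apply_eq_zero_of_separates hC hY
  ext a
  constructor <;> intro ha <;> obtain ⟨haS, Y, hY, hYa, hY0', hYlt⟩ := mem_activeSet.1 ha
  · have haω : a ≠ ω := by
      rintro rfl
      rw [hY0 Y hY] at hYa
      exact absurd hYa (by decide)
    exact mem_activeSet.2 ⟨Finset.mem_of_mem_insert_of_ne haS haω, Y, hY, hYa,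
      fun e he => hY0' e (Finset.mem_insert_of_mem he),
      fun e he => hYlt e (Finset.mem_insert_of_mem he)⟩
  · exact mem_activeSet.2 ⟨Finset.mem_insert_of_mem haS, Y, hY, hYa,
      Finset.forall_mem_insert _ _ _ |>.2 ⟨(hY0 Y hY).ge, hY0'⟩,
      Finset.forall_mem_insert _ _ _ |>.2 ⟨fun _ => hY0 Y hY, hYlt⟩⟩

end Activity

section ActivitySum

variable {α R : Type*} [CommRing R] {C D : Set (α → SignType)} {P Q T A : Finset α} {ω : α}

/-- The monomial `x ^ |P \ A| * u ^ |P ∩ A| * y ^ |Q \ A| * v ^ |Q ∩ A|` that the reorientation of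
`A` contributes if its sets of dual-active and of active elements are `P` and `Q`. -/
def activityTerm [DecidableEq α] (x u y v : R) (P Q A : Finset α) : R :=
  x ^ (P \ A).card * u ^ (P ∩ A).card * y ^ (Q \ A).card * v ^ (Q ∩ A).card

theorem activityTerm_comm [DecidableEq α] (x u y v : R) (P Q A : Finset α) :
    activityTerm x u y v P Q A = activityTerm y v x u Q P A := by
  simp only [activityTerm]
  ring

theorem activityTerm_insert [DecidableEq α] (x u y v : R) (hP : ω ∉ P) (hQ : ω ∉ Q) :
    activityTerm x u y v P Q (insert ω A) = activityTerm x u y v P Q A := by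
  simp only [activityTerm, Finset.sdiff_insert_of_notMem hP, Finset.sdiff_insert_of_notMem hQ,
    Finset.inter_insert_of_notMem hP, Finset.inter_insert_of_notMem hQ]

theorem activityTerm_insert_right [DecidableEq α] (x u y v : R) (hQ : ω ∉ Q) (hA : ω ∉ A) :
    activityTerm x u y v P (insert ω Q) A = y * activityTerm x u y v P Q A := by
  rw [activityTerm, activityTerm, Finset.insert_sdiff_of_notMem _ hA,
    Finset.insert_inter_of_notMem hA,
    Finset.card_insert_of_notMem fun h => hQ (Finset.mem_sdiff.1 h).1]
  ring

theorem activityTerm_insert_right_insert [DecidableEq α] (x u y v : R) (hP : ω ∉ P) (hQ : ω ∉ Q) :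
    activityTerm x u y v P (insert ω Q) (insert ω A) = v * activityTerm x u y v P Q A := by
  rw [← activityTerm_insert x u y v hP hQ, activityTerm, activityTerm, Finset.insert_sdiff_insert,
    Finset.sdiff_insert_of_notMem hQ, Finset.insert_inter_of_mem (Finset.mem_insert_self ω A),
    Finset.card_insert_of_notMem fun h => hQ (Finset.mem_inter.1 h).1]
  ring

variable [LinearOrder α]

/-- The sum over all reorientations of the monomials recording their active and dual-active
elements, for a pair of families of signed sets. -/
noncomputable def activitySum (C D : Set (α → SignType)) (S : Finset α) (x u y v : R) : R :=
  ∑ A ∈ S.powerset,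
    activityTerm x u y v (activeSet (flip A ⁻¹' D) S) (activeSet (flip A ⁻¹' C) S) A

theorem activitySum_comm (C D : Set (α → SignType)) (S : Finset α) (x u y v : R) :
    activitySum C D S x u y v = activitySum D C S y v x u :=
  Finset.sum_congr rfl fun _ _ => activityTerm_comm _ _ _ _ _ _ _

theorem activitySum_empty (C D : Set (α → SignType)) (x u y v : R) :
    activitySum C D ∅ x u y v = 1 := by
  simp [activitySum, activityTerm, activeSet]

theorem activitySum_insert (hω : ω ∉ T) (x u y v : R) :
    activitySum C D (insert ω T) x u y v = ∑ A ∈ T.powerset,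
      (activityTerm x u y v (activeSet (flip A ⁻¹' D) (insert ω T))
          (activeSet (flip A ⁻¹' C) (insert ω T)) A +
        activityTerm x u y v (activeSet (flip {ω} ⁻¹' (flip A ⁻¹' D)) (insert ω T))
          (activeSet (flip {ω} ⁻¹' (flip A ⁻¹' C)) (insert ω T)) (insert ω A)) := by
  rw [activitySum, Finset.sum_powerset_insert hω, ← Finset.sum_add_distrib]
  refine Finset.sum_congr rfl fun A hA => ?_
  have hωA : ω ∉ A := fun h => hω (Finset.mem_powerset.1 hA h)
  rw [preimage_flip_insert hωA, preimage_flip_insert hωA]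

theorem IsDualPair.activitySum_of_separates_left (h : IsDualPair (insert ω T) C D)
    (hωT : ∀ e ∈ T, e < ω) (hC : Separates C ω T) (x u y v : R) :
    activitySum C D (insert ω T) x u y v = (y + v) * activitySum (avoiding ω C) D T x u y v := by
  have hω : ω ∉ T := fun hω => (hωT ω hω).false
  have hω' : ∀ K, ω ∉ activeSet K T := fun K h => hω (activeSet_subset h)
  rw [activitySum_insert hω, activitySum, Finset.mul_sum]
  refine Finset.sum_congr rfl fun A hA => ?_
  have hωA : ω ∉ A := fun h => hω (Finset.mem_powerset.1 hA h)
  have hpair := h.reorient A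
  have hpair' := hpair.reorient {ω}
  have hloop : Separates (flip A ⁻¹' C) ω T := separates_preimage_flip.2 hC
  have hloop' : Separates (flip {ω} ⁻¹' (flip A ⁻¹' C)) ω T := separates_preimage_flip.2 hloop
  rw [hpair.activeSet_left_insert_of_separates hωT hloop,
    hpair.activeSet_right_insert_of_separates hloop,
    hpair'.activeSet_left_insert_of_separates hωT hloop',
    hpair'.activeSet_right_insert_of_separates hloop',
    activeSet_preimage_flip_singleton hω, avoiding_preimage_flip_singleton, avoiding_preimage_flip,
    activityTerm_insert_right _ _ _ _ (hω' _) hωA,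
    activityTerm_insert_right_insert _ _ _ _ (hω' _) (hω' _), add_mul]

theorem IsDualPair.activitySum_of_separates_right (h : IsDualPair (insert ω T) C D)
    (hωT : ∀ e ∈ T, e < ω) (hD : Separates D ω T) (x u y v : R) :
    activitySum C D (insert ω T) x u y v = (x + u) * activitySum C (avoiding ω D) T x u y v := by
  rw [activitySum_comm, h.symm.activitySum_of_separates_left hωT hD, activitySum_comm]

theorem IsDualPair.activitySum_delete_contract (h : IsDualPair (insert ω T) C D)
    (hωT : ∀ e ∈ T, e < ω) (hC : ¬Separates C ω T) (hD : ¬Separates D ω T) (x u y v : R) :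
    activitySum C D (insert ω T) x u y v =
      activitySum (avoiding ω C) D T x u y v + activitySum C (avoiding ω D) T x u y v := by
  have hω : ω ∉ T := fun hω => (hωT ω hω).false
  have hω' : ∀ K, ω ∉ activeSet K T := fun K h => hω (activeSet_subset h)
  rw [activitySum_insert hω, activitySum, activitySum, ← Finset.sum_add_distrib]
  refine Finset.sum_congr rfl fun A _ => ?_
  simp only [← avoiding_preimage_flip]
  rcases (h.reorient A).activeSet_dichotomy hωT (separates_preimage_flip.not.2 hC)
    (separates_preimage_flip.not.2 hD) with ⟨hO, hN, hO', hN'⟩ | ⟨hO, hN, hO', hN'⟩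
  · rw [hO, hN, hO', hN', activityTerm_insert _ _ _ _ (hω' _) (hω' _)]
  · rw [hO, hN, hO', hN', activityTerm_insert _ _ _ _ (hω' _) (hω' _), add_comm]

end ActivitySum

section RankFunction

variable {α R : Type*} [CommRing R] {C D : Set (α → SignType)} {r : Finset α → ℕ}
  {S T B : Finset α} {ω : α}

/-- The corank-nullity generating function of `r` on `S`, normalised so that adding a constant to
`r` does not change it: the nullity of `B` is `|B| - (r B - r ∅)`. -/
def corankNullitySum (r : Finset α → ℕ) (S : Finset α) (p q : R) : R :=
  ∑ B ∈ S.powerset, p ^ (r S - r B) * q ^ (B.card + r ∅ - r B)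

theorem corankNullitySum_empty (r : Finset α → ℕ) (p q : R) : corankNullitySum r ∅ p q = 1 := by
  simp [corankNullitySum]

variable [DecidableEq α]

/-- `r` is the rank function, up to an additive constant, of the matroid on `S` whose circuits and
cocircuits are the minimal supports of `C` and `D`. The constant makes contractions simple: the
rank function of the contraction of `ω` is `fun B => r (insert ω B)`. -/
structure IsRankFunction (r : Finset α → ℕ) (S : Finset α) (C D : Set (α → SignType)) : Prop where
  mono : Monotone r
  insert_le : ∀ a B, r (insert a B) ≤ r B + 1
  insert_eq : ∀ a ∈ S, ∀ B ⊆ S.erase a, Separates C a (S.erase a \ B) → r (insert a B) = r B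
  insert_eq_add_one : ∀ a ∈ S, ∀ B ⊆ S.erase a, Separates D a B → r (insert a B) = r B + 1

namespace IsRankFunction

theorem delete (h : IsRankFunction r (insert ω T) C D) (hω : ω ∉ T) :
    IsRankFunction r T (avoiding ω C) D where
  mono := h.mono
  insert_le := h.insert_le
  insert_eq a ha B hB hsep := by
    have hωa : ω ≠ a := fun h => hω (h ▸ ha)
    have hωB : ω ∉ B := fun h => hω (Finset.mem_of_mem_erase (hB h))
    refine h.insert_eq a (Finset.mem_insert_of_mem ha) B
      (hB.trans (Finset.erase_subset_erase a (Finset.subset_insert ω T))) ?_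
    rwa [Finset.erase_insert_of_ne hωa, Finset.insert_sdiff_of_notMem _ hωB, separates_insert_iff]
  insert_eq_add_one a ha B hB hsep :=
    h.insert_eq_add_one a (Finset.mem_insert_of_mem ha) B
      (hB.trans (Finset.erase_subset_erase a (Finset.subset_insert ω T))) hsep

theorem contract (h : IsRankFunction r (insert ω T) C D) (hω : ω ∉ T) :
    IsRankFunction (fun B => r (insert ω B)) T C (avoiding ω D) where
  mono _ _ hBB' := h.mono (Finset.insert_subset_insert ω hBB')
  insert_le a B := by
    rw [Finset.insert_comm]
    exact h.insert_le a (insert ω B)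
  insert_eq a ha B hB hsep := by
    have hωa : ω ≠ a := fun h => hω (h ▸ ha)
    rw [Finset.insert_comm]
    refine h.insert_eq a (Finset.mem_insert_of_mem ha) (insert ω B) ?_ ?_ <;>
      rw [Finset.erase_insert_of_ne hωa]
    · exact Finset.insert_subset_insert ω hB
    · rw [Finset.insert_sdiff_insert]
      exact hsep.anti (Finset.sdiff_subset_sdiff subset_rfl (Finset.subset_insert ω B))
  insert_eq_add_one a ha B hB hsep := by
    have hωa : ω ≠ a := fun h => hω (h ▸ ha)
    rw [Finset.insert_comm]
    refine h.insert_eq_add_one a (Finset.mem_insert_of_mem ha) (insert ω B) ?_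
      (separates_insert_iff.2 hsep)
    rw [Finset.erase_insert_of_ne hωa]
    exact Finset.insert_subset_insert ω hB

theorem le_card_add (h : IsRankFunction r S C D) (B : Finset α) : r B ≤ B.card + r ∅ := by
  induction B using Finset.induction_on with
  | empty => simp
  | insert a B haB ih =>
    rw [Finset.card_insert_of_notMem haB]
    have := h.insert_le a B
    lia

theorem insert_eq_of_separates_left (h : IsRankFunction r (insert ω T) C D) (hω : ω ∉ T)
    (hB : B ⊆ T) (hC : Separates C ω (T \ B)) : r (insert ω B) = r B := by
  refine h.insert_eq ω (Finset.mem_insert_self ω T) B ?_ ?_ <;> rwa [Finset.erase_insert hω]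

theorem insert_eq_of_separates_right (h : IsRankFunction r (insert ω T) C D) (hω : ω ∉ T)
    (hB : B ⊆ T) (hD : Separates D ω B) : r (insert ω B) = r B + 1 :=
  h.insert_eq_add_one ω (Finset.mem_insert_self ω T) B (by rwa [Finset.erase_insert hω]) hD

theorem corankNullitySum_of_separates_left (h : IsRankFunction r (insert ω T) C D) (hω : ω ∉ T)
    (hC : Separates C ω T) (p q : R) :
    corankNullitySum r (insert ω T) p q = (1 + q) * corankNullitySum r T p q := by
  have hr : ∀ B ⊆ T, r (insert ω B) = r B := fun B hB =>
    h.insert_eq_of_separates_left hω hB (hC.anti Finset.sdiff_subset)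
  rw [corankNullitySum, Finset.sum_powerset_insert hω, ← Finset.sum_add_distrib, corankNullitySum,
    Finset.mul_sum]
  refine Finset.sum_congr rfl fun B hB => ?_
  have hBT := Finset.mem_powerset.1 hB
  have hnullity : B.card + 1 + r ∅ - r B = B.card + r ∅ - r B + 1 := by
    have := h.le_card_add B
    lia
  rw [hr T subset_rfl, hr B hBT, Finset.card_insert_of_notMem fun h => hω (hBT h), hnullity]
  ring

theorem corankNullitySum_of_separates_right (h : IsRankFunction r (insert ω T) C D) (hω : ω ∉ T)
    (hD : Separates D ω T) (p q : R) :
    corankNullitySum r (insert ω T) p q =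
      (1 + p) * corankNullitySum (fun B => r (insert ω B)) T p q := by
  have hr : ∀ B ⊆ T, r (insert ω B) = r B + 1 := fun B hB =>
    h.insert_eq_of_separates_right hω hB (hD.anti hB)
  rw [corankNullitySum, Finset.sum_powerset_insert hω, ← Finset.sum_add_distrib, corankNullitySum,
    Finset.mul_sum]
  refine Finset.sum_congr rfl fun B hB => ?_
  have hBT := Finset.mem_powerset.1 hB
  have hcorank : r T + 1 - r B = r T - r B + 1 := by
    have := h.mono hBT
    lia
  have hnullity : B.card + (r ∅ + 1) - (r B + 1) = B.card + r ∅ - r B := by lia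
  have hnullity' : B.card + 1 + r ∅ - (r B + 1) = B.card + r ∅ - r B := by lia
  rw [hr T subset_rfl, hr B hBT, hr ∅ (Finset.empty_subset T),
    Finset.card_insert_of_notMem fun h => hω (hBT h), hcorank, Nat.add_sub_add_right, hnullity,
    hnullity']
  ring

theorem corankNullitySum_delete_contract (h : IsRankFunction r (insert ω T) C D) (hω : ω ∉ T)
    (hC : Separates C ω ∅) (hD : Separates D ω ∅) (p q : R) :
    corankNullitySum r (insert ω T) p q =
      corankNullitySum r T p q + corankNullitySum (fun B => r (insert ω B)) T p q := by
  have hT : r (insert ω T) = r T :=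
    h.insert_eq_of_separates_left hω subset_rfl (by rwa [Finset.sdiff_self])
  have h0 : r (insert ω ∅) = r ∅ + 1 :=
    h.insert_eq_of_separates_right hω (Finset.empty_subset T) hD
  rw [corankNullitySum, Finset.sum_powerset_insert hω, hT]
  refine congrArg₂ (· + ·) rfl (Finset.sum_congr rfl fun B hB => ?_)
  beta_reduce
  rw [Finset.card_insert_of_notMem fun h => hω (Finset.mem_powerset.1 hB h), hT, h0, add_assoc,
    add_comm 1]

end IsRankFunction

end RankFunction

theorem IsDualPair.corankNullitySum_eq_activitySum {α R : Type*} [LinearOrder α] [CommRing R]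
    {C D : Set (α → SignType)} {S : Finset α} {r : Finset α → ℕ} (h : IsDualPair S C D)
    (hr : IsRankFunction r S C D) (x u y v : R) :
    corankNullitySum r S (x + u - 1) (y + v - 1) = activitySum C D S x u y v := by
  induction S using Finset.induction_on_max generalizing C D r with
  | empty => rw [corankNullitySum_empty, activitySum_empty]
  | insert ω T hωT ih =>
    have hω : ω ∉ T := fun hω => (hωT ω hω).false
    have deletion := ih (h.delete hω) (hr.delete hω)
    have contraction := ih (h.contract hω) (hr.contract hω)
    by_cases hC : Separates C ω T
    · rw [hr.corankNullitySum_of_separates_left hω hC, h.activitySum_of_separates_left hωT hC,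
        deletion, add_sub_cancel]
    by_cases hD : Separates D ω T
    · rw [hr.corankNullitySum_of_separates_right hω hD, h.activitySum_of_separates_right hωT hD,
        contraction, add_sub_cancel]
    have herase : T ⊆ (insert ω T).erase ω := by rw [Finset.erase_insert hω]
    have hC' : Separates C ω ∅ := (h.separates ω (Finset.mem_insert_self ω T) ∅
      (Finset.empty_subset _) T herase (Finset.disjoint_empty_left T)).resolve_right hD
    have hD' : Separates D ω ∅ := (h.separates ω (Finset.mem_insert_self ω T) T herase ∅
      (Finset.empty_subset _) (Finset.disjoint_empty_right T)).resolve_left hC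
    rw [hr.corankNullitySum_delete_contract hω hC' hD',
      h.activitySum_delete_contract hωT hC hD, deletion, contraction]

end SignedSet

namespace SignedSet

theorem orthogonal_iff {α : Type*} {X Y : α → SignType} :
    Orthogonal X Y ↔ ((∀ e, 0 ≤ X e * Y e) → ∀ e, X e * Y e = 0) ∧
      ((∀ e, X e * Y e ≤ 0) → ∀ e, X e * Y e = 0) := by
  have nonneg : ∀ s : SignType, 0 ≤ s ↔ ¬s = -1 := by decide
  have nonpos : ∀ s : SignType, s ≤ 0 ↔ ¬s = 1 := by decide
  have zero : ∀ s : SignType, s = 0 ↔ ¬s = 1 ∧ ¬s = -1 := by decide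
  have not_exists_eq (s : SignType) : (∀ e, ¬X e * Y e = s) ↔ ¬∃ e, X e * Y e = s :=
    not_exists.symm
  simp only [Orthogonal, nonneg, nonpos, zero, forall_and, not_exists_eq]
  tauto

theorem orthogonal_flip {α : Type*} [DecidableEq α] (A : Finset α) (X Y : α → SignType) :
    Orthogonal (flip A X) (flip A Y) ↔ Orthogonal X Y := by
  simp only [Orthogonal, flip_apply_mul_flip_apply]

theorem nonneg_and_isLeast_support_iff {α : Type*} [LinearOrder α] {X : α → SignType}
    {S : Finset α} {a : α} (hX : Function.support X ⊆ S) :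
    (∀ e, 0 ≤ X e) ∧ IsLeast (Function.support X) a ↔
      X a = 1 ∧ (∀ e ∈ S, 0 ≤ X e) ∧ ∀ e ∈ S, e < a → X e = 0 := by
  constructor
  · rintro ⟨hpos, hXa, hle⟩
    refine ⟨(by decide : ∀ s : SignType, 0 ≤ s → s ≠ 0 → s = 1) _ (hpos a) hXa,
      fun e _ => hpos e, fun e _ hea => ?_⟩
    by_contra hXe
    exact (hle hXe).not_gt hea
  · rintro ⟨hXa, hpos, hlt⟩
    refine ⟨fun e => ?_, by simp [hXa], fun e he => ?_⟩
    · by_cases heS : e ∈ S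
      · exact hpos e heS
      · exact (not_not.1 fun h => heS (hX h)).ge
    · by_contra! hea
      exact he (hlt e (hX he) hea)

end SignedSet

section Cocircuit

variable {α : Type*} {N : Matroid α} {K B W : Set α} {a e f : α}

theorem exists_isCocircuit_of_notMem_closure (ha : a ∈ N.E) (haW : a ∉ N.closure W) :
    ∃ K, N.IsCocircuit K ∧ a ∈ K ∧ Disjoint K W := by
  obtain ⟨I, hI⟩ := N.exists_isBasis' W
  rw [← hI.closure_eq_closure] at haW
  obtain ⟨haI, haI'⟩ := hI.indep.notMem_closure_iff.1 haW
  obtain ⟨B, hB, hIB⟩ := haI.exists_isBase_superset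
  obtain ⟨haB, hIB⟩ := Set.insert_subset_iff.1 hIB
  refine ⟨_, hB.compl_closure_sdiff_singleton_isCocircuit haB,
    ⟨ha, hB.indep.notMem_closure_sdiff_of_mem haB⟩, Set.disjoint_left.2 fun z hz hzW => hz.2 ?_⟩
  refine N.closure_subset_closure (Set.subset_sdiff_singleton hIB haI') ?_
  rw [hI.closure_eq_closure]
  exact N.mem_closure_of_mem' hzW hz.1

theorem notMem_closure_of_isCocircuit (hK : N.IsCocircuit K) (ha : a ∈ K) (hKW : Disjoint K W) :
    a ∉ N.closure W := fun haW => by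
  obtain ⟨C, hCW, hC, haC⟩ :=
    Matroid.exists_isCircuit_of_mem_closure haW (Set.disjoint_left.1 hKW ha)
  refine hC.inter_isCocircuit_ne_singleton hK (e := a) ?_
  refine Set.Subset.antisymm (fun z ⟨hzC, hzK⟩ => ?_) (Set.singleton_subset_iff.2 ⟨haC, ha⟩)
  exact (hCW hzC).resolve_right (Set.disjoint_left.1 hKW hzK)

theorem mem_closure_insert_of_isCocircuit (hK : N.IsCocircuit K) (he : e ∈ K) (hf : f ∈ K)
    (hB : N.IsBasis B (N.E \ K)) : f ∈ N.closure (insert e B) := by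
  by_contra hfB
  rw [N.closure_insert_congr_right hB.closure_eq_closure] at hfB
  obtain ⟨K', hK', -, hdisj⟩ :=
    exists_isCocircuit_of_notMem_closure (hK.subset_ground hf) hfB
  rw [Set.disjoint_insert_right] at hdisj
  have hK'K : K' ⊆ K := fun z hz => by
    by_contra hzK
    exact Set.disjoint_left.1 hdisj.2 hz ⟨hK'.subset_ground hz, hzK⟩
  exact hdisj.1 (hK'.isCircuit.eq_of_subset_isCircuit hK.isCircuit hK'K ▸ he)

end Cocircuit

namespace OrientedMatroid

variable {α : Type*} {M : OrientedMatroid α} {X Y C : α → SignType} {B I J K L U : Set α}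
  {a e y : α}

instance : M.underlying.Finite := ⟨M.E.finite_toSet⟩

theorem IsCircuit.isCircuit_support (hX : M.IsCircuit X) :
    M.underlying.IsCircuit (Function.support X) := by
  rw [Matroid.isCircuit_iff_forall_ssubset]
  refine ⟨⟨fun h => h.2 X hX subset_rfl, M.support_subset X hX⟩, fun I hI =>
    ⟨hI.subset.trans (M.support_subset X hX), fun Y hY hYI => hI.not_subset ?_⟩⟩
  rcases M.incomparable Y X hY hX (hYI.trans hI.subset) with rfl | rfl
  · exact hYI
  · rwa [support_neg_eq] at hYI

theorem exists_isCircuit_support_eq (hK : M.underlying.IsCircuit K) :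
    ∃ X, M.IsCircuit X ∧ Function.support X = K := by
  obtain ⟨X, hX, hXK⟩ : ∃ X, M.IsCircuit X ∧ Function.support X ⊆ K := by
    by_contra! h
    exact hK.not_indep ⟨hK.subset_ground, h⟩
  exact ⟨X, hX, hX.isCircuit_support.eq_of_subset_isCircuit hK hXK⟩

theorem exists_isCircuit_of_mem_closure (ha : a ∈ M.underlying.closure I) (haI : a ∉ I)
    {s : SignType} (hs : s ≠ 0) :
    ∃ X, M.IsCircuit X ∧ X a = s ∧ Function.support X ⊆ insert a I := by
  obtain ⟨K, hKI, hK, haK⟩ := Matroid.exists_isCircuit_of_mem_closure ha haI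
  obtain ⟨X, hX, rfl⟩ := exists_isCircuit_support_eq hK
  rcases (by decide : ∀ s t : SignType, s ≠ 0 → t ≠ 0 → s = t ∨ -s = t) _ _ haK hs with h | h
  · exact ⟨X, hX, h, hKI⟩
  · exact ⟨-X, M.isCircuit_neg X hX, h, by rwa [support_neg_eq]⟩

theorem elimination_of_eq_neg (hX : M.IsCircuit X) (hY : M.IsCircuit Y) (hne : X ≠ -Y)
    (he : X e ≠ 0) (hXY : X e = -Y e) :
    ∃ Z, M.IsCircuit Z ∧ Z e = 0 ∧ ∀ f, Z f = 0 ∨ Z f = X f ∨ Z f = Y f := by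
  have conformal : ∀ r s t : SignType, (r = 1 → s = 1 ∨ t = 1) → (r = -1 → s = -1 ∨ t = -1) →
      r = 0 ∨ r = s ∨ r = t := by decide
  rcases (by decide : ∀ s t : SignType, s ≠ 0 → s = -t → s = 1 ∧ t = -1 ∨ s = -1 ∧ t = 1) _ _ he hXY
    with ⟨hXe, hYe⟩ | ⟨hXe, hYe⟩
  · obtain ⟨Z, hZ, hZe, hpos, hneg⟩ := M.elimination X Y e hX hY hne hXe hYe
    exact ⟨Z, hZ, hZe, fun f => conformal _ _ _ (hpos f) (hneg f)⟩
  · obtain ⟨Z, hZ, hZe, hpos, hneg⟩ := M.elimination Y X e hY hX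
      (fun h => hne (by rw [h, neg_neg])) hYe hXe
    exact ⟨Z, hZ, hZe, fun f => conformal _ _ _ (fun h => (hpos f h).symm)
      fun h => (hneg f h).symm⟩

/-- No circuit with support in `U` has only nonnegative products with `Y`. This is the half of
orthogonality to `Y` that is preserved by elimination. -/
def Blocks (M : OrientedMatroid α) (Y : α → SignType) (U : Set α) : Prop :=
  ∀ X, M.IsCircuit X → Function.support X ⊆ U → ¬∀ e, 0 ≤ X e * Y e

theorem Blocks.anti (h : M.Blocks Y U) (hKU : K ⊆ U) : M.Blocks Y K :=
  fun X hX hXK => h X hX (hXK.trans hKU)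

theorem Blocks.eq_neg (h : M.Blocks Y U) (hX : M.IsCircuit X) (hC : M.IsCircuit C)
    (hXU : Function.support X ⊆ insert y U) (hCU : Function.support C ⊆ insert y U)
    (hXY : ∀ e, 0 ≤ X e * Y e) (hCY : ∀ e ≠ y, 0 ≤ C e * Y e) (hXC : X y ≠ 0 → X y = -C y) :
    X = -C := by
  by_contra hne
  have hXy : X y ≠ 0 := fun hXy => h X hX (fun e he => (hXU he).resolve_left
    fun hey => he (hey ▸ hXy)) hXY
  obtain ⟨Z, hZ, hZy, hZXC⟩ := elimination_of_eq_neg hX hC hne hXy (hXC hXy)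
  refine h Z hZ (fun e he => ?_) fun e => ?_
  · have hey : e ≠ y := fun hey => he (hey ▸ hZy)
    rcases hZXC e with h0 | hZX | hZC
    · exact absurd h0 he
    · exact (hXU (by rwa [Function.mem_support, ← hZX])).resolve_left hey
    · exact (hCU (by rwa [Function.mem_support, ← hZC])).resolve_left hey
  · by_cases hey : e = y
    · rw [hey, hZy, zero_mul]
    · rcases hZXC e with h0 | hZX | hZC
      · rw [h0, zero_mul]
      · exact hZX ▸ hXY e
      · exact hZC ▸ hCY e hey

theorem exists_isCircuit_of_isCocircuit (hK : M.underlying.IsCocircuit K)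
    (hB : M.underlying.IsBasis B (M.underlying.E \ K)) (he : e ∈ K) (hy : y ∈ K) (hye : y ≠ e) :
    ∃ X, M.IsCircuit X ∧ X e = 1 ∧ X y ≠ 0 ∧ Function.support X ⊆ insert e (insert y B) := by
  have heB : e ∉ insert y B := by
    rintro (rfl | heB)
    exacts [hye rfl, (hB.subset heB).2 he]
  obtain ⟨X, hX, hXe, hXB⟩ := exists_isCircuit_of_mem_closure
    (mem_closure_insert_of_isCocircuit hK hy he hB) heB one_ne_zero
  refine ⟨X, hX, hXe, fun hXy => ?_, hXB⟩
  refine notMem_closure_of_isCocircuit hK he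
    (Set.disjoint_right.2 fun b hb => (hB.subset hb).2) ?_
  refine M.underlying.closure_subset_closure ?_
    (hX.isCircuit_support.mem_closure_sdiff_singleton_of_mem (e := e) (by simp [hXe]))
  rintro z ⟨hz, hze⟩
  exact ((hXB hz).resolve_left hze).resolve_left fun hzy => hz (hzy ▸ hXy)

theorem blocks_insert_union (hB : M.underlying.Indep (insert e B)) (hYe : Y e = 1)
    (hYB : ∀ b ∈ B, Y b = 0) (hL : L.Finite)
    (hYL : ∀ f ∈ L, Y f ≠ 0 ∧ ∃ C, M.IsCircuit C ∧ C e = 1 ∧ C f = -Y f ∧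
      Function.support C ⊆ insert e (insert f B)) :
    M.Blocks Y (insert e B ∪ L) := by
  induction L, hL using Set.Finite.induction_on with
  | empty =>
    rw [Set.union_empty]
    exact fun X hX hXB _ => hB.2 X hX hXB
  | @insert f L _ _ ih =>
    obtain ⟨⟨hYf, C, hC, hCe, hCf, hCB⟩, hYL⟩ := Set.forall_mem_insert.1 hYL
    rw [Set.union_insert]
    intro X hX hXU hXY
    have hXC : X = -C := by
      refine (ih hYL).eq_neg hX hC hXU (hCB.trans ?_) hXY (fun z hzf => ?_) fun hXf => ?_
      · rw [Set.insert_comm]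
        exact Set.insert_subset_insert Set.subset_union_left
      · by_cases hCz : C z = 0
        · rw [hCz, zero_mul]
        rcases hCB hCz with rfl | hz | hzB
        · rw [hCe, hYe]; decide
        · exact absurd hz hzf
        · rw [hYB z hzB, mul_zero]
      · have sign_eq : ∀ s t : SignType, s ≠ 0 → t ≠ 0 → 0 ≤ s * t → s = t := by decide
        rw [hCf, neg_neg]
        exact sign_eq _ _ hXf hYf (hXY f)
    have := hXY e
    rw [hXC, Pi.neg_apply, hCe, hYe] at this
    exact absurd this (by decide)

theorem exists_blocks (hK : M.underlying.IsCocircuit K)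
    (hB : M.underlying.IsBasis B (M.underlying.E \ K)) :
    ∃ Y, Function.support Y = K ∧ M.Blocks Y (B ∪ K) := by
  classical
  obtain ⟨e, he⟩ := hK.nonempty
  -- The fundamental circuits of the base `insert e B` force the signs on `K \ {e}`.
  choose! C hC hCe hCf hCB using fun f (hf : f ∈ K \ {e}) =>
    exists_isCircuit_of_isCocircuit hK hB he hf.1 hf.2
  let Y : α → SignType := fun f => if f = e then 1 else if f ∈ K then -C f f else 0
  have hYe : Y e = 1 := if_pos rfl
  have hYf : ∀ f ∈ K \ {e}, Y f = -C f f := fun f hf => (if_neg hf.2).trans (if_pos hf.1)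
  have hYf0 : ∀ f ∈ K \ {e}, Y f ≠ 0 := fun f hf => by
    rw [hYf f hf]
    exact (by decide : ∀ s : SignType, s ≠ 0 → -s ≠ 0) _ (hCf f hf)
  have hYK : ∀ f ∉ K, Y f = 0 := fun f hf =>
    (if_neg (ne_of_mem_of_not_mem he hf).symm).trans (if_neg hf)
  refine ⟨Y, Set.ext fun f => ⟨not_imp_comm.1 (hYK f), fun hf => ?_⟩, ?_⟩
  · by_cases hfe : f = e
    · rw [hfe, Function.mem_support, hYe]; decide
    · exact hYf0 f ⟨hf, hfe⟩
  · refine (blocks_insert_union ?_ hYe (fun b hb => hYK b (hB.subset hb).2) ?_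
      fun f hf => ⟨hYf0 f hf, C f, hC f hf, hCe f hf, by rw [hYf f hf, neg_neg], hCB f hf⟩).anti ?_
    · refine (hB.indep.notMem_closure_iff (hK.subset_ground he)).1 ?_ |>.1
      exact notMem_closure_of_isCocircuit hK he (Set.disjoint_right.2 fun b hb => (hB.subset hb).2)
    · exact (M.E.finite_toSet.subset hK.subset_ground).sdiff
    · rintro f (hf | hf)
      · exact Or.inl (Or.inr hf)
      · exact (em (f = e)).imp Or.inl fun hfe => ⟨hf, hfe⟩

theorem Blocks.exchange (h : M.Blocks Y (B ∪ Function.support Y))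
    (hB : M.underlying.IsBasis B (M.underlying.E \ Function.support Y))
    (hy : y ∈ M.underlying.E \ Function.support Y) (hyB : y ∉ B) (hJ : M.underlying.Indep J)
    (hJB : J ⊆ insert y B) : M.Blocks Y (J ∪ Function.support Y) := by
  intro X hX hXJ hXY
  have hXU : Function.support X ⊆ insert y (B ∪ Function.support Y) := by
    rw [← Set.insert_union]
    exact hXJ.trans (Set.union_subset_union_left _ hJB)
  have hXy : X y ≠ 0 := fun hXy => h X hX (fun e he => (hXU he).resolve_left
    fun hey => he (hey ▸ hXy)) hXY
  obtain ⟨C, hC, hCy, hCB⟩ := exists_isCircuit_of_mem_closure (hB.subset_closure hy) hyB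
    ((by decide : ∀ s : SignType, s ≠ 0 → -s ≠ 0) _ hXy)
  have hCY : ∀ e, C e ≠ 0 → Y e = 0 := fun e he => by
    rcases hCB he with rfl | heB
    exacts [not_not.1 hy.2, not_not.1 (hB.subset heB).2]
  have hXC : X = -C := h.eq_neg hX hC hXU
    (hCB.trans (Set.insert_subset_insert Set.subset_union_left)) hXY
    (fun e _ => (mul_eq_zero.2 (or_iff_not_imp_left.2 (hCY e))).ge) (fun _ => by rw [hCy, neg_neg])
  refine hJ.2 X hX fun e he => (hXJ he).resolve_right fun heY => heY (hCY e ?_)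
  rwa [← Function.mem_support, ← support_neg_eq, ← hXC]

theorem Blocks.of_isBasis (h : M.Blocks Y (B ∪ Function.support Y))
    (hB : M.underlying.IsBasis B (M.underlying.E \ Function.support Y))
    (hJ : M.underlying.IsBasis J (M.underlying.E \ Function.support Y)) :
    M.Blocks Y (J ∪ Function.support Y) := by
  induction hn : (B \ J).ncard using Nat.strong_induction_on generalizing B with
  | _ n ih =>
    by_cases hBJ : B ⊆ J
    · rwa [← hB.eq_of_subset_indep hJ.indep hBJ hJ.subset]
    obtain ⟨e, heB, heJ⟩ := Set.not_subset.1 hBJ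
    obtain ⟨y, ⟨hyJ, hyB⟩, hB'⟩ := hB.exchange hJ ⟨heB, heJ⟩
    refine ih _ ?_ (h.exchange hB (hJ.subset hyJ) hyB hB'.indep
      (Set.insert_subset_insert Set.sdiff_subset)) hB' rfl
    rw [← hn, Set.insert_sdiff_of_mem _ hyJ, Set.sdiff_sdiff_comm]
    exact Set.ncard_sdiff_singleton_lt_of_mem ⟨heB, heJ⟩ (hB.indep.finite.sdiff)

theorem Blocks.mul_eq_zero (h : M.Blocks Y (B ∪ Function.support Y))
    (hB : M.underlying.IsBasis B (M.underlying.E \ Function.support Y)) (hX : M.IsCircuit X)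
    (hXY : ∀ e, 0 ≤ X e * Y e) (e : α) : X e * Y e = 0 := by
  by_contra hne
  obtain ⟨hXe, hYe⟩ := mul_ne_zero_iff.1 hne
  have hI : M.underlying.Indep (Function.support X \ Function.support Y) :=
    hX.isCircuit_support.ssubset_indep ⟨Set.sdiff_subset, fun h => (h hXe).2 hYe⟩
  obtain ⟨J, hJ, hIJ⟩ := hI.subset_isBasis_of_subset
    (X := M.underlying.E \ Function.support Y)
    (Set.sdiff_subset_sdiff_left (M.support_subset X hX))
  exact h.of_isBasis hB hJ X hX (Set.sdiff_subset_iff.1 hIJ |>.trans_eq (Set.union_comm _ _)) hXY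

theorem exists_isCocircuit_support_eq (hK : M.underlying.IsCocircuit K) :
    ∃ Y, M.IsCocircuit Y ∧ Function.support Y = K := by
  obtain ⟨B, hB⟩ := M.underlying.exists_isBasis (M.underlying.E \ K)
  obtain ⟨Y, rfl, hY⟩ := exists_blocks hK hB
  refine ⟨Y, ⟨hK, fun X hX => SignedSet.orthogonal_iff.2
    ⟨hY.mul_eq_zero hB hX, fun hXY e => ?_⟩⟩, rfl⟩
  have nonneg_neg : ∀ s t : SignType, s * t ≤ 0 → 0 ≤ -s * t := by decide
  have := hY.mul_eq_zero hB (M.isCircuit_neg X hX) (fun f => nonneg_neg _ _ (hXY f)) e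
  exact (by decide : ∀ s t : SignType, -s * t = 0 → s * t = 0) _ _ this

theorem IsCocircuit.neg (hY : M.IsCocircuit Y) : M.IsCocircuit (-Y) := by
  refine ⟨by rw [support_neg_eq]; exact hY.1, fun X hX => ?_⟩
  simpa only [SignedSet.Orthogonal, Pi.neg_apply, neg_mul, mul_neg] using
    hY.2 (-X) (M.isCircuit_neg X hX)

variable (M)

theorem coe_rank (B : Finset α) : (M.rank B : ℕ∞) = M.underlying.eRk B :=
  ENat.natCast_toNat
    ((M.underlying.eRk_le_encard B).trans_lt B.finite_toSet.encard_lt_top).ne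

section Duality

variable [DecidableEq α]

theorem isDualPair : SignedSet.IsDualPair M.E {X | M.IsCircuit X} {Y | M.IsCocircuit Y} where
  neg_left := M.isCircuit_neg
  neg_right _ := IsCocircuit.neg
  orthogonal X hX Y hY hXY e _ := by
    refine (SignedSet.orthogonal_iff.1 (hY.2 X hX)).1 (fun f => ?_) e
    by_cases hf : f ∈ M.E
    · exact hXY f hf
    · rw [Function.notMem_support.1 fun h => hf (M.support_subset X hX h), zero_mul]
  separates a ha V hV W hW hVW := by
    by_cases haW : a ∈ M.underlying.closure W
    · obtain ⟨X, hX, hXa, hXW⟩ := exists_isCircuit_of_mem_closure haW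
        (fun h => Finset.notMem_erase a M.E (hW h)) one_ne_zero
      refine Or.inl ⟨X, hX, hXa ▸ one_ne_zero, fun e he => ?_⟩
      by_contra hXe
      rcases hXW hXe with rfl | heW
      · exact Finset.notMem_erase e M.E (hV he)
      · exact Finset.disjoint_left.1 hVW he heW
    · obtain ⟨K, hK, haK, hKW⟩ := exists_isCocircuit_of_notMem_closure ha haW
      obtain ⟨Y, hY, rfl⟩ := exists_isCocircuit_support_eq hK
      exact Or.inr ⟨Y, hY, haK, fun e he => not_not.1 (Set.disjoint_right.1 hKW he)⟩

theorem isRankFunction :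
    SignedSet.IsRankFunction M.rank M.E {X | M.IsCircuit X} {Y | M.IsCocircuit Y} where
  mono B B' h := by
    rw [← Nat.cast_le (α := ℕ∞), coe_rank, coe_rank]
    exact M.underlying.eRk_mono (Finset.coe_subset.2 h)
  insert_le a B := by
    rw [← Nat.cast_le (α := ℕ∞), Nat.cast_add, coe_rank, coe_rank, Finset.coe_insert]
    exact M.underlying.eRk_insert_le_add_one a B
  insert_eq a _ B _ := by
    rintro ⟨X, hX, hXa, hXB⟩
    have haB : a ∈ M.underlying.closure B := by
      refine M.underlying.closure_subset_closure ?_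
        (hX.isCircuit_support.mem_closure_sdiff_singleton_of_mem hXa)
      rintro e ⟨he, hea⟩
      by_contra heB
      exact he (hXB e (Finset.mem_sdiff.2
        ⟨Finset.mem_erase.2 ⟨hea, M.support_subset X hX he⟩, heB⟩))
    rw [rank, rank, Finset.coe_insert, ← Matroid.eRk_closure_eq,
      Matroid.closure_insert_eq_of_mem_closure haB, Matroid.eRk_closure_eq]
  insert_eq_add_one a ha B _ := by
    rintro ⟨Y, hY, hYa, hYB⟩
    have haB : a ∉ M.underlying.closure B :=
      notMem_closure_of_isCocircuit hY.1 hYa (Set.disjoint_right.2 fun e he => not_not.2 (hYB e he))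
    rw [← Nat.cast_inj (R := ℕ∞), Nat.cast_add, coe_rank, coe_rank, Finset.coe_insert,
      Matroid.eRk_insert_eq_add_one ⟨ha, haB⟩, Nat.cast_one]

theorem underlying_reorient (A : Finset α) : (M.reorient A).underlying = M.underlying := by
  refine Matroid.ext_indep rfl fun I _ => and_congr_right fun _ =>
    ⟨fun h X hX hXI => h (SignedSet.flip A X) ?_ ?_, fun h X hX hXI => h _ hX ?_⟩
  · change M.IsCircuit (SignedSet.flip A (SignedSet.flip A X))
    rwa [SignedSet.flip_flip]
  · rwa [SignedSet.support_flip]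
  · rwa [SignedSet.support_flip]

theorem isCocircuit_reorient_iff (A : Finset α) (Y : α → SignType) :
    (M.reorient A).IsCocircuit Y ↔ M.IsCocircuit (SignedSet.flip A Y) := by
  rw [IsCocircuit, IsCocircuit, underlying_reorient, SignedSet.support_flip]
  refine and_congr_right fun _ => ⟨fun h X hX => ?_, fun h X hX => ?_⟩
  · rw [← SignedSet.orthogonal_flip A, SignedSet.flip_flip]
    refine h _ (show M.IsCircuit _ from ?_)
    rwa [SignedSet.flip_flip]
  · rw [← SignedSet.orthogonal_flip A]
    exact h _ hX

end Duality

section Activity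

variable [LinearOrder α]

theorem active_eq_activeSet : M.active = SignedSet.activeSet {X | M.IsCircuit X} M.E := by
  ext a
  classical
  simp only [active, Finset.mem_filter, SignedSet.mem_activeSet]
  refine and_congr_right fun _ => exists_congr fun X => and_congr_right fun hX => ?_
  exact SignedSet.nonneg_and_isLeast_support_iff (M.support_subset X hX)

theorem dualActive_eq_activeSet :
    M.dualActive = SignedSet.activeSet {Y | M.IsCocircuit Y} M.E := by
  ext a
  classical
  simp only [dualActive, Finset.mem_filter, SignedSet.mem_activeSet]
  refine and_congr_right fun _ => exists_congr fun Y => and_congr_right fun hY => ?_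
  exact SignedSet.nonneg_and_isLeast_support_iff hY.1.subset_ground

theorem dualActive_reorient (A : Finset α) : (M.reorient A).dualActive =
    SignedSet.activeSet (SignedSet.flip A ⁻¹' {Y | M.IsCocircuit Y}) M.E := by
  rw [dualActive_eq_activeSet]
  congr 1
  exact Set.ext (M.isCocircuit_reorient_iff A)

theorem active_reorient (A : Finset α) : (M.reorient A).active =
    SignedSet.activeSet (SignedSet.flip A ⁻¹' {X | M.IsCircuit X}) M.E :=
  (M.reorient A).active_eq_activeSet

end Activity

end OrientedMatroid

theorem theorem7p4 {α : Type*} [LinearOrder α] (M : OrientedMatroid α)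
    {R : Type*} [CommRing R] (x u y v : R) :
    MvPolynomial.aeval ![x + u, y + v] M.tuttePolynomial =
      ∑ A ∈ M.E.powerset, x ^ (M.thetaStar A).card * u ^ (M.thetaStarBar A).card *
        y ^ (M.theta A).card * v ^ (M.thetaBar A).card := by
  have rank_empty : M.rank ∅ = 0 := by simp [OrientedMatroid.rank]
  have tutte_eq : MvPolynomial.aeval ![x + u, y + v] M.tuttePolynomial =
      SignedSet.corankNullitySum M.rank M.E (x + u - 1) (y + v - 1) := by
    simp [OrientedMatroid.tuttePolynomial, SignedSet.corankNullitySum, rank_empty]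
  rw [tutte_eq, M.isDualPair.corankNullitySum_eq_activitySum M.isRankFunction]
  simp only [SignedSet.activitySum, SignedSet.activityTerm, OrientedMatroid.thetaStar,
    OrientedMatroid.thetaStarBar, OrientedMatroid.theta, OrientedMatroid.thetaBar,
    M.active_reorient, M.dualActive_reorient]
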